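/- Let $R$ be a commutative ring. All modules are $\mathbb Z$-graded, differentials have degree $+1$, dga's are unital and associative, and the Koszul sign rule is used. In particular $(f\otimes g)(x\otimes y)=(-1)^{|g||x|}f(x)\otimes g(y)$. A dga $A$ is *1-reduced* if $A^i=0$ for $i<0$, $A^0=R$ (embedded by the unit) and $A^1=0$. A *dg Hopf algebra* $C$ is a connected dga ($C^i=0$ for $i<0$, $C^0=R$) that is also a coassociative counital dg coalgebra, with comultiplication $\Delta:C\to C\otimes C$ a map of algebras. A *dga comodule* over $C$ is a dga $M$ with a coassociative counital left coaction $\nu:M\to C\otimes M$ that is a map of dga's. For a 1-reduced dga $A$ the bar construction $BA$ is the tensor coalgebra on $s^{-1}A_{>0}$ (with deconcatenation; $[a_1|\dots|a_n]$ has degree $\sum(|a_i|-1)$), with differential $$d[a_1|\dots|a_n]=-\sum_{i\ge 1}(-1)^{\varepsilon_i}[a_1|\dots|da_i|\dots|a_n]-\sum_{i\ge 2}(-1)^{\varepsilon_i}[a_1|\dots|a_{i-1}a_i|\dots|a_n],\qquad \varepsilon_i=\sum_{j<i}(|a_j|-1).$$ A linear map $f$ of degree $1$ from a dg coalgebra $D$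 to $A$ is a *twisting cochain* if $df+fd=-f\smile f$, where $f\smile f=\mu_A(f\otimes f)\Delta_D$. Its *comultiplicative extension* $D\to BA$ is $x\mapsto\sum_{k\ge0}\sum[f(x^1)|\dots|f(x^k)]$, where $\sum x^1\otimes\dots\otimes x^k$ is the iterated comultiplication of $x$ (the counit for $k=0$); here $D$ is $C$ or $BA\otimes BA$. A *homotopy G-algebra* is a 1-reduced dga $A$ with linear operations $E_{p,q}:A_{>0}^{\otimes p}\otimes A_{>0}^{\otimes q}\to A$ ($p,q\ge0$, $p+q>0$) of degree $1-p-q$ such that * $E_{1,0}=\mathrm{id}$, $E_{0,1}=\mathrm{id}$, and all other $E_{p,q}$ vanish except possibly the $E_{k,1}$ with $k\ge1$; * the map $E:BA\otimes BA\to A$, $E([a_1|\dots|a_p]\otimes[b_1|\dots|b_q])=E_{p,q}(a_1,\dots,a_p;b_1,\dots,b_q)$, $E(1\otimes 1)=0$, is a twisting cochain; * its comultiplicative extension $\mu_E:BA\otimes BA\to BA$ is associative, i.e. $BA$ is a dg Hopf algebra. The operations are extended to a last argument $b\in A^0$ by $E_{0,1}(b)=b$ and $E_{k,1}(a_1,\dots,a_k;b)=0$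 for $k\ge1$. A twisting cochain $\phi:C\to A$ is *multiplicative* if its comultiplicative extension $C\to BA$ is a map of algebras for $\mu_E$ (so that it is a map of dg Hopf algebras). **Theorem.** Let $A$ be a homotopy G-algebra, $C$ a dg Hopf algebra, $\phi:C\to A$ a multiplicative twisting cochain and $M$ a dga comodule over $C$. Put $$d_\phi=d\otimes 1+1\otimes d-\phi\cap-,\qquad \phi\cap(a\otimes m)=\sum(-1)^{|a|}a\,\phi(c)\otimes m'\quad\text{for }\nu(m)=\sum c\otimes m',$$ $$\mu_\phi\big((a_1\otimes m_1)\otimes(a_2\otimes m_2)\big)=\sum_{k\ge0}\sum(-1)^{|a_2||m_1^{k+1}|+|c^1|+\dots+|c^k|}\,a_1E_{k,1}\big(\phi(c^1),\dots,\phi(c^k);a_2\big)\otimes m_1^{k+1}m_2,$$ where $\sum c^1\otimes\dots\otimes c^k\otimes m_1^{k+1}\in C^{\otimes k}\otimes M$ is the $k$-fold iterated coaction of $m_1$ ($m_1$ itself for $k=0$). Then the sum over $k$ is finite, and $A\otimes M$ with the total grading, the differential $d_\phi$, the multiplication $\mu_\phi$ and the unit $1\otimes1$ is a dga. Explicitly: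 $d_\phi$ has degree $1$ and $d_\phi^2=0$; $\mu_\phi$ has degree $0$, is associative and has the unit $1\otimes 1$; and $d_\phi$ is a derivation of $\mu_\phi$. -/

import Mathlib

open scoped TensorProduct DirectSum

noncomputable section

namespace TwistedTensor

/-! ### Graded modules and the Koszul sign rule -/

section Graded

variable {R V W : Type*} [CommRing R] [AddCommGroup V] [Module R V] [AddCommGroup W] [Module R W]

/-- A `ℤ`-grading of an `R`-module: a family of submodules of which it is the direct sum. -/
structure Grading (R V : Type*) [CommRing R] [AddCommGroup V] [Module R V] where
  gr : ℤ → Submodule R V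
  internal : DirectSum.IsInternal gr

/-- The decomposition of a graded module into its homogeneous components. -/
def Grading.split (G : Grading R V) : V ≃ₗ[R] ⨁ i, G.gr i :=
  (LinearEquiv.ofBijective (DirectSum.coeLinearMap G.gr)
    (show Function.Bijective (DirectSum.coeLinearMap G.gr) from G.internal)).symm

/-- The linear map on `V` given on the component of degree `i` by `f i`. -/
def Grading.sum {X : Type*} [AddCommMonoid X] [Module R X] (G : Grading R V)
    (f : ∀ i, G.gr i →ₗ[R] X) : V →ₗ[R] X :=
  DirectSum.toModule R ℤ X f ∘ₗ G.split.toLinearMap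

theorem Grading.sum_of_mem {X : Type*} [AddCommMonoid X] [Module R X] (G : Grading R V)
    (f : ∀ i, G.gr i →ₗ[R] X) {i : ℤ} {v : V} (hv : v ∈ G.gr i) : G.sum f v = f i ⟨v, hv⟩ := by
  have h : G.split v = DirectSum.lof R ℤ (fun i => G.gr i) i ⟨v, hv⟩ := by
    rw [Grading.split, LinearEquiv.symm_apply_eq]
    simp
  simp only [Grading.sum, LinearMap.comp_apply, LinearEquiv.coe_coe, h, DirectSum.toModule_lof]

/-- `w ↦ (-1)^{n |w|} w`. -/
def Grading.signPow (G : Grading R V) (n : ℤ) : V →ₗ[R] V :=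
  G.sum fun j => (n * j).negOnePow • (G.gr j).subtype

/-- `v ↦ (-1)^{|v|} v`. -/
def Grading.sgn (G : Grading R V) : V →ₗ[R] V := G.signPow 1

theorem Grading.sgn_of_mem (G : Grading R V) {i : ℤ} {v : V} (hv : v ∈ G.gr i) :
    G.sgn v = i.negOnePow • v := by
  simp [Grading.sgn, Grading.signPow, G.sum_of_mem _ hv]

/-- The Koszul interchange `v ⊗ w ↦ (-1)^{|v||w|} w ⊗ v`. -/
def braid (G : Grading R V) (H : Grading R W) : V ⊗[R] W →ₗ[R] W ⊗[R] V :=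
  TensorProduct.lift (G.sum fun i =>
    ((TensorProduct.mk R W V).flip ∘ₗ (G.gr i).subtype).compl₂ (H.signPow i))

theorem braid_of_mem (G : Grading R V) (H : Grading R W) {i j : ℤ} {v : V} {w : W}
    (hv : v ∈ G.gr i) (hw : w ∈ H.gr j) :
    braid G H (v ⊗ₜ w) = (i * j).negOnePow • (w ⊗ₜ[R] v) := by
  simp [braid, G.sum_of_mem _ hv, Grading.signPow, H.sum_of_mem _ hw,
    Units.smul_def, TensorProduct.smul_tmul']

/-- The degree `n` part of a tensor product of graded modules. -/
def tensorGr (G : Grading R V) (H : Grading R W) (n : ℤ) : Submodule R (V ⊗[R] W) :=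
  Submodule.span R {z | ∃ i j : ℤ, ∃ v ∈ G.gr i, ∃ w ∈ H.gr j, i + j = n ∧ z = v ⊗ₜ w}

/-- The tensor differential `v ⊗ w ↦ d v ⊗ w + (-1)^{|v|} v ⊗ d w`. -/
def tensorD (G : Grading R V) (d : V →ₗ[R] V) (d' : W →ₗ[R] W) :
    V ⊗[R] W →ₗ[R] V ⊗[R] W :=
  TensorProduct.map d LinearMap.id + TensorProduct.map G.sgn d'

/-- `(v ⊗ w) ⊗ (x ⊗ y) ↦ ± (v ⊗ x) ⊗ (w ⊗ y)`, where `w ⊗ x` is interchanged by `β`. -/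
def midSwap {X Y : Type*} [AddCommGroup X] [Module R X] [AddCommGroup Y] [Module R Y]
    (β : W ⊗[R] X →ₗ[R] X ⊗[R] W) :
    (V ⊗[R] W) ⊗[R] (X ⊗[R] Y) →ₗ[R] (V ⊗[R] X) ⊗[R] (W ⊗[R] Y) :=
  (TensorProduct.assoc R V X (W ⊗[R] Y)).symm.toLinearMap ∘ₗ
    LinearMap.lTensor V
      ((TensorProduct.assoc R X W Y).toLinearMap ∘ₗ LinearMap.rTensor Y β ∘ₗ
        (TensorProduct.assoc R W X Y).symm.toLinearMap) ∘ₗ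
    (TensorProduct.assoc R V W (X ⊗[R] Y)).toLinearMap

end Graded

/-! ### Differential graded algebras, Hopf algebras and comodules -/

section DG

/-- A (`ℤ`-graded, unital, associative) dga with differential of degree `1`. -/
structure DGAlgebra (R V : Type*) [CommRing R] [AddCommGroup V] [Module R V]
    extends Grading R V where
  d : V →ₗ[R] V
  mul : V →ₗ[R] V →ₗ[R] V
  one : V
  d_mem : ∀ i, ∀ v ∈ gr i, d v ∈ gr (i + 1)
  d_d : ∀ v, d (d v) = 0
  one_mem : one ∈ gr 0
  mul_mem : ∀ i j, ∀ v ∈ gr i, ∀ w ∈ gr j, mul v w ∈ gr (i + j)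
  mul_assoc : ∀ u v w, mul (mul u v) w = mul u (mul v w)
  one_mul : ∀ v, mul one v = v
  mul_one : ∀ v, mul v one = v
  leibniz : ∀ i, ∀ v ∈ gr i, ∀ w, d (mul v w) = mul (d v) w + i.negOnePow • mul v (d w)

variable {R V W : Type*} [CommRing R] [AddCommGroup V] [Module R V] [AddCommGroup W] [Module R W]

/-- Non-negatively graded with degree `0` part `R` (embedded by the unit). -/
structure DGAlgebra.IsConnected (A : DGAlgebra R V) : Prop where
  neg : ∀ i < 0, A.gr i = ⊥
  zero : A.gr 0 = Submodule.span R {A.one}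
  inj : ∀ r : R, r • A.one = 0 → r = 0

/-- Connected, with vanishing degree `1` part. -/
structure DGAlgebra.IsOneReduced (A : DGAlgebra R V) : Prop extends A.IsConnected where
  deg_one : A.gr 1 = ⊥

/-- The product `(a ⊗ b)(a' ⊗ b') = (-1)^{|b||a'|} a a' ⊗ b b'` of a tensor product of dga's. -/
def tensorMul (A : DGAlgebra R V) (B : DGAlgebra R W) :
    (V ⊗[R] W) ⊗[R] (V ⊗[R] W) →ₗ[R] V ⊗[R] W :=
  TensorProduct.map (TensorProduct.lift A.mul) (TensorProduct.lift B.mul) ∘ₗ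
    midSwap (braid B.toGrading A.toGrading)

/-- A connected dg Hopf algebra: a connected dga with a compatible structure of a dg coalgebra
such that the comultiplication is a map of algebras. -/
structure DGHopfAlgebra (R V : Type*) [CommRing R] [AddCommGroup V] [Module R V]
    extends DGAlgebra R V where
  connected : toDGAlgebra.IsConnected
  comul : V →ₗ[R] V ⊗[R] V
  counit : V →ₗ[R] R
  comul_mem : ∀ n, ∀ c ∈ gr n, comul c ∈ tensorGr toGrading toGrading n
  counit_of_ne : ∀ n ≠ 0, ∀ c ∈ gr n, counit c = 0
  coassoc : ∀ c, TensorProduct.assoc R V V V (LinearMap.rTensor V comul (comul c)) =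
    LinearMap.lTensor V comul (comul c)
  counit_comul : ∀ c, TensorProduct.lid R V (LinearMap.rTensor V counit (comul c)) = c
  comul_counit : ∀ c, TensorProduct.rid R V (LinearMap.lTensor V counit (comul c)) = c
  comul_d : ∀ c, comul (d c) = tensorD toGrading d d (comul c)
  comul_one : comul one = one ⊗ₜ one
  comul_mul : ∀ b c, comul (mul b c) = tensorMul toDGAlgebra toDGAlgebra (comul b ⊗ₜ comul c)

/-- A structure of a (left) comodule on a dga `M` over a dg Hopf algebra `C`, whose coaction
`M → C ⊗ M` is a map of dga's. -/
structure DGComodule (C : DGHopfAlgebra R V) (M : DGAlgebra R W) where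
  coact : W →ₗ[R] V ⊗[R] W
  coact_mem : ∀ n, ∀ m ∈ M.gr n, coact m ∈ tensorGr C.toGrading M.toGrading n
  coassoc : ∀ m, TensorProduct.assoc R V V W (LinearMap.rTensor W C.comul (coact m)) =
    LinearMap.lTensor V coact (coact m)
  counit_coact : ∀ m, TensorProduct.lid R W (LinearMap.rTensor W C.counit (coact m)) = m
  coact_d : ∀ m, coact (M.d m) = tensorD C.toGrading C.d M.d (coact m)
  coact_one : coact M.one = C.one ⊗ₜ M.one
  coact_mul : ∀ m n, coact (M.mul m n) = tensorMul C.toDGAlgebra M (coact m ⊗ₜ coact n)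

end DG

/-! ### The bar construction -/

section Bar

variable {R V : Type*} [CommRing R] [AddCommGroup V] [Module R V] (A : DGAlgebra R V)

/-- The part `A_{>0}` of positive degree. -/
def DGAlgebra.pos : Submodule R V := ⨆ i : {i : ℤ // 0 < i}, A.gr i

theorem DGAlgebra.gr_le_pos {i : ℤ} (hi : 0 < i) : A.gr i ≤ A.pos :=
  le_iSup (fun i : {i : ℤ // 0 < i} => A.gr i) ⟨i, hi⟩

/-- The projection of `A` onto `A_{>0}` that kills the components of degree `≤ 0`. -/
def DGAlgebra.toPos : V →ₗ[R] A.pos :=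
  A.sum fun i => if hi : 0 < i then Submodule.inclusion (A.gr_le_pos hi) else 0

/-- The underlying module `T(s⁻¹ A_{>0})` of the bar construction. The product of this tensor
algebra is the concatenation of words; it is used only to write words down. -/
abbrev Bar : Type _ := TensorAlgebra R A.pos

/-- The letter `[a]`. -/
abbrev letter : A.pos →ₗ[R] Bar A := TensorAlgebra.ι R

/-- The word `[a₁|…|aₙ]`. -/
def word (l : List A.pos) : Bar A := (l.map (letter A)).prod

/-- The elements of degree `n` of `BA`: spanned by the words `[a₁|…|aₖ]` with `aᵢ` homogeneous
of positive degree and `∑ (|aᵢ| - 1) = n`. -/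
def barGr (n : ℤ) : Submodule R (Bar A) :=
  Submodule.span R {x | ∃ l : List (Σ i : {i : ℤ // 0 < i}, A.gr i),
    (l.map fun p => p.1.1 - 1).sum = n ∧
      x = word A (l.map fun p => Submodule.inclusion (A.gr_le_pos p.1.2) p.2)}

instance barGr_gradedMonoid : SetLike.GradedMonoid (barGr A) where
  one_mem := Submodule.subset_span ⟨[], by simp, by simp [word]⟩
  mul_mem := by
    intro i j x y hx hy
    induction hx, hy using Submodule.span_induction₂ with
    | mem_mem x y hx hy =>
      obtain ⟨l, hl, rfl⟩ := hx
      obtain ⟨l', hl', rfl⟩ := hy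
      exact Submodule.subset_span ⟨l ++ l', by simp [hl, hl'], by simp [word]⟩
    | zero_left y hy => simp
    | zero_right x hx => simp
    | add_left x y z _ _ _ h1 h2 => rw [add_mul]; exact add_mem h1 h2
    | add_right x y z _ _ _ h1 h2 => rw [mul_add]; exact add_mem h1 h2
    | smul_left r x y _ _ h => rw [smul_mul_assoc]; exact Submodule.smul_mem _ _ h
    | smul_right r x y _ _ h => rw [mul_smul_comm]; exact Submodule.smul_mem _ _ h

theorem letter_mem {i : ℤ} (hi : 0 < i) (a : A.gr i) :
    letter A (Submodule.inclusion (A.gr_le_pos hi) a) ∈ barGr A (i - 1) :=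
  Submodule.subset_span ⟨[⟨⟨i, hi⟩, a⟩], by simp, by simp [word]⟩

/-- The decomposition of a letter into its homogeneous components. -/
def letterSplit : A.pos →ₗ[R] ⨁ n, barGr A n :=
  (A.sum fun i => if hi : 0 < i then
      DirectSum.lof R ℤ (fun n => barGr A n) (i - 1) ∘ₗ
        LinearMap.codRestrict (barGr A (i - 1))
          (letter A ∘ₗ Submodule.inclusion (A.gr_le_pos hi)) (fun a => letter_mem A hi a)
    else 0) ∘ₗ A.pos.subtype

theorem letterSplit_of_mem {i : ℤ} (hi : 0 < i) (a : A.gr i) :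
    letterSplit A (Submodule.inclusion (A.gr_le_pos hi) a) =
      DirectSum.of (fun n => barGr A n) (i - 1)
        ⟨letter A (Submodule.inclusion (A.gr_le_pos hi) a), letter_mem A hi a⟩ := by
  have h : ((Submodule.inclusion (A.gr_le_pos hi) a : A.pos) : V) ∈ A.gr i := a.2
  simp only [letterSplit, LinearMap.comp_apply, Submodule.subtype_apply, A.sum_of_mem _ h, hi]
  rfl

theorem pos_induction {p : A.pos → Prop}
    (mem : ∀ (i : ℤ) (hi : 0 < i) (a : A.gr i), p (Submodule.inclusion (A.gr_le_pos hi) a))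
    (zero : p 0) (add : ∀ a b, p a → p b → p (a + b)) (a : A.pos) : p a := by
  obtain ⟨a, ha⟩ := a
  refine Submodule.iSup_induction' (motive := fun a ha => p ⟨a, ha⟩) _
    (fun i x hx => mem i.1 i.2 ⟨x, hx⟩) zero ?_ ha
  intro x y hx hy h1 h2
  exact add _ _ h1 h2

instance barGradedAlgebra : GradedAlgebra (barGr A) :=
  GradedAlgebra.ofAlgHom (barGr A) (TensorAlgebra.lift R (letterSplit A))
    (by
      ext a
      simp only [LinearMap.comp_apply, AlgHom.toLinearMap_apply, AlgHom.comp_apply,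
        TensorAlgebra.lift_ι_apply, AlgHom.id_apply]
      induction a using pos_induction with
      | mem i hi a =>
        rw [letterSplit_of_mem A hi a]
        exact DirectSum.coeAlgHom_of (barGr A) _ _
      | zero => simp
      | add a b h1 h2 => simp only [map_add, h1, h2])
    (by
      have key : ∀ l : List (Σ i : {i : ℤ // 0 < i}, A.gr i), ∀ n,
          (l.map fun p => p.1.1 - 1).sum = n → ∀ h,
          TensorAlgebra.lift R (letterSplit A)
            (word A (l.map fun p => Submodule.inclusion (A.gr_le_pos p.1.2) p.2)) =
          DirectSum.of (fun n => barGr A n) n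
            ⟨word A (l.map fun p => Submodule.inclusion (A.gr_le_pos p.1.2) p.2), h⟩ := by
        intro l
        induction l with
        | nil =>
          rintro n rfl h
          simp only [word, List.map_nil, List.prod_nil, map_one]
          rfl
        | cons p l ih =>
          rintro n rfl h
          have hl : word A (l.map fun p => Submodule.inclusion (A.gr_le_pos p.1.2) p.2) ∈
              barGr A (l.map fun p => p.1.1 - 1).sum := Submodule.subset_span ⟨l, rfl, rfl⟩
          have e : word A ((p :: l).map fun p => Submodule.inclusion (A.gr_le_pos p.1.2) p.2) =
              letter A (Submodule.inclusion (A.gr_le_pos p.1.2) p.2) *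
              word A (l.map fun p => Submodule.inclusion (A.gr_le_pos p.1.2) p.2) := by
            simp [word]
          simp only [e, map_mul, TensorAlgebra.lift_ι_apply, ih _ rfl hl]
          rw [letterSplit_of_mem A p.1.2 p.2, DirectSum.of_mul_of]
          rfl
      rintro n ⟨x, hx⟩
      simp only
      induction hx using Submodule.span_induction with
      | mem x hx =>
        obtain ⟨l, hl, rfl⟩ := hx
        exact key l n hl _
      | zero =>
        rw [map_zero]
        exact (map_zero (DirectSum.of (fun n => barGr A n) n)).symm
      | add x y hx hy h1 h2 =>
        rw [map_add, h1, h2, ← map_add]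
        rfl
      | smul r x hx h =>
        rw [map_smul, h]
        exact ((DirectSum.lof R ℤ (fun n => barGr A n) n).map_smul r ⟨x, hx⟩).symm)

/-- The bar construction is graded by the submodules `barGr`. -/
def barGrading : Grading R (Bar A) where
  gr := barGr A
  internal := DirectSum.Decomposition.isInternal (barGr A)

/-- Recursion over words: the linear map with value `w₀` at the empty word `1` and with
`f ([a] x) = s a x + s' a (f x)`. -/
def barRec {W : Type*} [AddCommGroup W] [Module R W] (w₀ : W) (s : A.pos →ₗ[R] Bar A →ₗ[R] W)
    (s' : A.pos →ₗ[R] W →ₗ[R] W) : Bar A →ₗ[R] W :=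
  LinearMap.snd R (Bar A) W ∘ₗ LinearMap.applyₗ ((1, w₀) : Bar A × W) ∘ₗ
    (TensorAlgebra.lift R
      ({ toFun := fun a => (LinearMap.mulLeft R (letter A a) ∘ₗ LinearMap.fst R (Bar A) W).prod
            (LinearMap.coprod (s a) (s' a))
         map_add' := fun a b => by ext <;> simp [add_mul]
         map_smul' := fun r a => by ext <;> simp } :
        A.pos →ₗ[R] Module.End R (Bar A × W))).toLinearMap

section barRec

variable {W : Type*} [AddCommGroup W] [Module R W] (w₀ : W) (s : A.pos →ₗ[R] Bar A →ₗ[R] W)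
    (s' : A.pos →ₗ[R] W →ₗ[R] W)

theorem barRec_one : barRec A w₀ s s' 1 = w₀ := by
  simp [barRec]

theorem barRec_cons (a : A.pos) (x : Bar A) :
    barRec A w₀ s s' (letter A a * x) = s a x + s' a (barRec A w₀ s s' x) := by
  have h : ∀ (y z : Bar A) (w : W), ((TensorAlgebra.lift R
      ({ toFun := fun a => (LinearMap.mulLeft R (letter A a) ∘ₗ LinearMap.fst R (Bar A) W).prod
            (LinearMap.coprod (s a) (s' a))
         map_add' := fun a b => by ext <;> simp [add_mul]
         map_smul' := fun r a => by ext <;> simp } :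
        A.pos →ₗ[R] Module.End R (Bar A × W))) y (z, w)).1 = y * z := by
    intro y
    induction y using TensorAlgebra.induction with
    | algebraMap r => intro z w; simp [Algebra.algebraMap_eq_smul_one]
    | ι a => intro z w; simp
    | mul a b h1 h2 => intro z w; rw [map_mul, Module.End.mul_apply, h1, h2, mul_assoc]
    | add a b h1 h2 => intro z w; simp [h1, h2, add_mul]
  simp [barRec, h]

end barRec

/-- The counit of `BA`. -/
def barCounit : Bar A →ₗ[R] R := TensorAlgebra.algebraMapInv.toLinearMap

/-- Deconcatenation `[a₁|…|aₙ] ↦ ∑ [a₁|…|aᵢ] ⊗ [aᵢ₊₁|…|aₙ]`, defined by the recursion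
`Δ 1 = 1 ⊗ 1` and `Δ ([a] x) = 1 ⊗ [a] x + ([a] ⊗ 1) Δ x`. -/
def deconc : Bar A →ₗ[R] Bar A ⊗[R] Bar A :=
  barRec A (1 ⊗ₜ 1)
    ((LinearMap.mul R (Bar A) ∘ₗ letter A).compr₂ (TensorProduct.mk R (Bar A) (Bar A) 1))
    (LinearMap.rTensorHom (Bar A) ∘ₗ LinearMap.mul R (Bar A) ∘ₗ letter A)

theorem deconc_one : deconc A 1 = 1 ⊗ₜ 1 := barRec_one _ _ _ _

theorem deconc_cons (a : A.pos) (x : Bar A) :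
    deconc A (letter A a * x) = 1 ⊗ₜ (letter A a * x) +
      LinearMap.rTensor (Bar A) (LinearMap.mulLeft R (letter A a)) (deconc A x) :=
  barRec_cons _ _ _ _ _ _

/-- `a ↦ (-1)^{|a| - 1} a`. -/
def barSgn : A.pos →ₗ[R] A.pos := -(A.toPos ∘ₗ A.sgn ∘ₗ A.pos.subtype)

/-- `[b₁|…|bₙ] ↦ (a ↦ [a b₁|b₂|…|bₙ])` for `n ≥ 1`, and `1 ↦ 0`. -/
def merge : Bar A →ₗ[R] A.pos →ₗ[R] Bar A :=
  barRec A 0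
    (LinearMap.mk₂ R
      (fun (b : A.pos) (x : Bar A) => LinearMap.mulRight R x ∘ₗ letter A ∘ₗ A.toPos ∘ₗ
        A.mul.flip (b : V) ∘ₗ A.pos.subtype)
      (fun b b' x => by ext; simp [add_mul]) (fun r b x => by ext; simp)
      (fun b x x' => by ext; simp [mul_add]) (fun r b x => by ext; simp)) 0

theorem merge_one (a : A.pos) : merge A 1 a = 0 := by
  simp [merge, barRec_one]

theorem merge_cons (a b : A.pos) (x : Bar A) :
    merge A (letter A b * x) a = letter A (A.toPos (A.mul a b)) * x := by
  simp [merge, barRec_cons]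

/-- The differential `d₁ + d₂` of the bar construction, where
`d₁ [a₁|…|aₙ] = -∑ᵢ (-1)^{εᵢ} [a₁|…|d aᵢ|…|aₙ]` and
`d₂ [a₁|…|aₙ] = -∑_{i ≥ 2} (-1)^{εᵢ} [a₁|…|aᵢ₋₁ aᵢ|…|aₙ]` with `εᵢ = ∑_{j < i} (|aⱼ| - 1)`,
defined by recursion on the length of a word, see `barD_one` and `barD_cons`. -/
def barD : Bar A →ₗ[R] Bar A :=
  barRec A 0
    (-(LinearMap.mul R (Bar A) ∘ₗ letter A ∘ₗ A.toPos ∘ₗ A.d ∘ₗ A.pos.subtype) -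
      (merge A).flip ∘ₗ barSgn A)
    (LinearMap.mul R (Bar A) ∘ₗ letter A ∘ₗ barSgn A)

theorem barD_one : barD A 1 = 0 := barRec_one _ _ _ _

theorem barD_cons (a : A.pos) (x : Bar A) :
    barD A (letter A a * x) = -(letter A (A.toPos (A.d a)) * x) - merge A x (barSgn A a) +
      letter A (barSgn A a) * barD A x :=
  barRec_cons _ _ _ _ _ _

/-- The comultiplication of the coalgebra `BA ⊗ BA`. -/
def barTensorComul : Bar A ⊗[R] Bar A →ₗ[R] (Bar A ⊗[R] Bar A) ⊗[R] (Bar A ⊗[R] Bar A) :=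
  midSwap (braid (barGrading A) (barGrading A)) ∘ₗ TensorProduct.map (deconc A) (deconc A)

/-- The counit of the coalgebra `BA ⊗ BA`. -/
def barTensorCounit : Bar A ⊗[R] Bar A →ₗ[R] R :=
  (TensorProduct.lid R R).toLinearMap ∘ₗ TensorProduct.map (barCounit A) (barCounit A)

end Bar

/-! ### Twisting cochains and comultiplicative extensions -/

section Twisting

variable {R V D : Type*} [CommRing R] [AddCommGroup V] [Module R V] [AddCommGroup D] [Module R D]

/-- Brown's condition `d f + f d = -(f ⌣ f)` for a map `f` of degree `1` from a dg coalgebra `D`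
to a dga `A`. Here `f ⌣ f = μ (f ⊗ f) Δ`, where `(f ⊗ f) (x ⊗ y) = (-1)^{|x|} f x ⊗ f y`; the
coalgebra is given by its sign involution `x ↦ (-1)^{|x|} x`, its differential and its
comultiplication. -/
def BrownCondition (sgn dD : D →ₗ[R] D) (Δ : D →ₗ[R] D ⊗[R] D) (A : DGAlgebra R V)
    (f : D →ₗ[R] V) : Prop :=
  ∀ x, A.d (f x) + f (dD x) =
    -(TensorProduct.lift A.mul (TensorProduct.map (f ∘ₗ sgn) f (Δ x)))

/-- `x ↦ ∑ [f x⁽¹⁾|…|f x⁽ᵏ⁾]`, the sum being the `k`-fold iterated comultiplication of `x`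
(the counit, if `k = 0`). -/
def extTerm (Δ : D →ₗ[R] D ⊗[R] D) (ε : D →ₗ[R] R) (A : DGAlgebra R V) (f : D →ₗ[R] V) :
    ℕ → D →ₗ[R] Bar A
  | 0 => Algebra.linearMap R (Bar A) ∘ₗ ε
  | k + 1 => LinearMap.mul' R (Bar A) ∘ₗ
      TensorProduct.map (letter A ∘ₗ A.toPos ∘ₗ f) (extTerm Δ ε A f k) ∘ₗ Δ

open Classical in
/-- The comultiplicative extension `x ↦ ∑ₖ ∑ [f x⁽¹⁾|…|f x⁽ᵏ⁾]` from `D` to `BA` of a map `f`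
from `D` to `A`. It is defined when the sum over `k` is finite for every `x`. -/
def comulExt (Δ : D →ₗ[R] D ⊗[R] D) (ε : D →ₗ[R] R) (A : DGAlgebra R V) (f : D →ₗ[R] V) :
    D →ₗ[R] Bar A :=
  if h : ∀ x, (Function.support fun k => extTerm Δ ε A f k x).Finite then
    { toFun := fun x => ∑ᶠ k, extTerm Δ ε A f k x
      map_add' := fun x y => by
        simp only [map_add]
        exact finsum_add_distrib (h x) (h y)
      map_smul' := fun r x => by
        simp only [map_smul, RingHom.id_apply]
        exact (smul_finsum' r (h x)).symm }
  else 0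

end Twisting

/-! ### Homotopy G-algebras -/

section HGA

variable {R V : Type*} [CommRing R] [AddCommGroup V] [Module R V]

/-- A homotopy G-algebra structure on the dga `A`. The operations
`E_{p,q}(a₁,…,aₚ; b₁,…,b_q) = E([a₁|…|aₚ] ⊗ [b₁|…|b_q])`, `aᵢ, bⱼ ∈ A_{>0}`, are recorded as one
linear map `E` on `BA ⊗ BA`. -/
structure HomotopyGAlgebra (A : DGAlgebra R V) where
  reduced : A.IsOneReduced
  E : Bar A ⊗[R] Bar A →ₗ[R] V
  /-- `E_{p,q}` is of degree `1 - p - q`. -/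
  E_mem : ∀ n, ∀ z ∈ tensorGr (barGrading A) (barGrading A) n, E z ∈ A.gr (n + 1)
  /-- `E_{1,0} = id`. -/
  E_one_zero : ∀ a, E (letter A a ⊗ₜ 1) = a
  /-- `E_{0,1} = id`. -/
  E_zero_one : ∀ b, E (1 ⊗ₜ letter A b) = b
  /-- `E_{p,q} = 0` unless `(p,q) = (1,0)` or `q = 1`. -/
  E_eq_zero : ∀ l l' : List A.pos, ¬ (l.length = 1 ∧ l'.length = 0) → l'.length ≠ 1 →
    E (word A l ⊗ₜ word A l') = 0
  /-- `E` is a twisting cochain on `BA ⊗ BA`. -/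
  brown : BrownCondition (TensorProduct.map (barGrading A).sgn (barGrading A).sgn)
    (tensorD (barGrading A) (barD A) (barD A)) (barTensorComul A) A E
  /-- The comultiplicative extension `μ_E : BA ⊗ BA → BA` of `E` is associative. -/
  assoc : ∀ x y z : Bar A,
    comulExt (barTensorComul A) (barTensorCounit A) A E
        (comulExt (barTensorComul A) (barTensorCounit A) A E (x ⊗ₜ y) ⊗ₜ z) =
      comulExt (barTensorComul A) (barTensorCounit A) A E
        (x ⊗ₜ comulExt (barTensorComul A) (barTensorCounit A) A E (y ⊗ₜ z))

variable {A : DGAlgebra R V}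

/-- The multiplication `μ_E : BA ⊗ BA → BA`. -/
def HomotopyGAlgebra.barMul (H : HomotopyGAlgebra A) : Bar A ⊗[R] Bar A →ₗ[R] Bar A :=
  comulExt (barTensorComul A) (barTensorCounit A) A H.E

/-- The operations `E_{k,1}` with last argument in all of `A`: it sends `[a₁|…|aₖ]` and `b` to
`E_{k,1}(a₁,…,aₖ; b)` if `b ∈ A_{>0}`. For `b ∈ A⁰` the value is `b` if `k = 0`, and `0` if
`k ≥ 1` (the operations are normalized). -/
def HomotopyGAlgebra.op (H : HomotopyGAlgebra A) : Bar A →ₗ[R] V →ₗ[R] V :=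
  (TensorProduct.curry H.E).compl₂ (letter A ∘ₗ A.toPos) +
    (LinearMap.lsmul R V ∘ₗ barCounit A).compl₂ (LinearMap.id - A.pos.subtype ∘ₗ A.toPos)

end HGA

/-! ### Twisted tensor products -/

section TwistedTensorProduct

variable {R V U W : Type*} [CommRing R] [AddCommGroup V] [Module R V] [AddCommGroup U] [Module R U]
  [AddCommGroup W] [Module R W] {A : DGAlgebra R V} {C : DGHopfAlgebra R U} {M : DGAlgebra R W}

/-- `φ : C → A` is a multiplicative twisting cochain: it has degree `1`, satisfies Brown's
condition, and its comultiplicative extension `C → BA` is a map of algebras. -/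
structure IsMultiplicativeTwistingCochain (H : HomotopyGAlgebra A) (C : DGHopfAlgebra R U)
    (φ : U →ₗ[R] V) : Prop where
  degree : ∀ n, ∀ c ∈ C.gr n, φ c ∈ A.gr (n + 1)
  brown : BrownCondition C.sgn C.d C.comul A φ
  map_one : comulExt C.comul C.counit A φ C.one = 1
  map_mul : ∀ b c, comulExt C.comul C.counit A φ (C.mul b c) =
    H.barMul (comulExt C.comul C.counit A φ b ⊗ₜ comulExt C.comul C.counit A φ c)

/-- `φ ∩ (a ⊗ m) = ∑ (-1)^{|a|} a φ(c) ⊗ m'`, where `m ↦ ∑ c ⊗ m'` under the coaction. -/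
def cap (A : DGAlgebra R V) (N : DGComodule C M) (φ : U →ₗ[R] V) :
    V ⊗[R] W →ₗ[R] V ⊗[R] W :=
  LinearMap.rTensor W (TensorProduct.lift A.mul ∘ₗ TensorProduct.map A.sgn φ) ∘ₗ
    (TensorProduct.assoc R V U W).symm.toLinearMap ∘ₗ LinearMap.lTensor V N.coact

/-- The twisted differential `d ⊗ 1 + 1 ⊗ d - φ ∩ -`. With Brown's condition in the form
`d φ + φ d = -(φ ⌣ φ)` and the Koszul sign in `φ ∩ -`, this is the choice of sign with square `0`. -/
def twistedD (A : DGAlgebra R V) (N : DGComodule C M) (φ : U →ₗ[R] V) :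
    V ⊗[R] W →ₗ[R] V ⊗[R] W :=
  tensorD A.toGrading A.d M.d - cap A N φ

/-- `(a₁ ⊗ c) ⊗ a₂ ↦ (-1)^{|c|} a₁ E_{k,1}(φ c¹, …, φ cᵏ; a₂)`, where `c ↦ ∑ c¹ ⊗ … ⊗ cᵏ` under the
iterated comultiplication. -/
def twistedFactor (H : HomotopyGAlgebra A) (C : DGHopfAlgebra R U) (φ : U →ₗ[R] V) (k : ℕ) :
    (V ⊗[R] U) ⊗[R] V →ₗ[R] V :=
  TensorProduct.lift A.mul ∘ₗ
    LinearMap.lTensor V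
      (TensorProduct.lift (H.op ∘ₗ extTerm C.comul C.counit A φ k ∘ₗ C.sgn)) ∘ₗ
    (TensorProduct.assoc R V U V).toLinearMap

/-- The `k`-th summand of the twisted multiplication,
`(a₁ ⊗ m₁) ⊗ (a₂ ⊗ m₂) ↦
  ∑ (-1)^{|a₂||m₁'| + |c¹| + … + |cᵏ|} a₁ E_{k,1}(φ c¹, …, φ cᵏ; a₂) ⊗ m₁' m₂`,
where `m₁ ↦ ∑ c¹ ⊗ … ⊗ cᵏ ⊗ m₁'` under the iterated coaction. The sign is the one given by the
Koszul rule: `a₂` moves past `m₁'`, and the desuspension `a₂ ↦ [a₂]`, which precedes the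
application of `E`, moves past the `cⁱ`. -/
def twistedMulTerm (H : HomotopyGAlgebra A) (N : DGComodule C M) (φ : U →ₗ[R] V) (k : ℕ) :
    (V ⊗[R] W) ⊗[R] (V ⊗[R] W) →ₗ[R] V ⊗[R] W :=
  TensorProduct.map (twistedFactor H C φ k) (TensorProduct.lift M.mul) ∘ₗ
    midSwap (braid M.toGrading A.toGrading) ∘ₗ
    LinearMap.rTensor (V ⊗[R] W)
      ((TensorProduct.assoc R V U W).symm.toLinearMap ∘ₗ LinearMap.lTensor V N.coact)

end TwistedTensorProduct

end TwistedTensor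

end

open TwistedTensor

/-!
The theorem is that a "twisted" smash product is a dga. Let `f : C → BA` be the comultiplicative
extension of `φ`, a map of dg Hopf algebras. The operations `E_{k,1}` define a map
`T : C ⊗ A → A`, `T c a = (-1)^{|c|} ∑ E_{k,1}(φ c⁽¹⁾, …, φ c⁽ᵏ⁾; a)` of degree `0`, and in terms of
`T` the multiplication `μ_φ` is the usual product
`(a₁ ⊗ m₁)(a₂ ⊗ m₂) = ∑ ± a₁ T c a₂ ⊗ m₁' m₂` of a smash product (`smashMul`).

*Properties of `T`* (`IsTwistedAction`). The defining conditions of a homotopy G-algebra become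
statements about `T`. The twisting cochain condition for `E` on `[a₁|…|aₖ] ⊗ [a]` says that `T`
is a chain map up to a graded commutator with `φ` (`HomotopyGAlgebra.d_op`). The same condition on
`[a₁|…|aₖ] ⊗ [a|b]`, where `E` itself vanishes, is the Cartan formula for `T c (a b)`
(`HomotopyGAlgebra.op_mul`). The projection of the associativity of `μ_E` to words of length one
says that `A` is a module over the algebra `BA` (`HomotopyGAlgebra.op_barMul`), and
multiplicativity of `φ` turns it into a module over `C` and computes `φ (b c)`. To pull these
identities back along `f` one needs that `f` is a map of dg coalgebras (`deconc_comulExt`,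
`barD_comulExt`). Both follow from the recursion `f c = ε c + ∑ [φ c₁] f c₂` (`comulExt_rec`),
because a linear map on `C` is determined by such a recursion: `φ` vanishes in degree `0`, so
the degree of the argument drops (`eq_zero_of_rec`). For the same reason the sums over `k` are
finite.

*The smash product.* Associativity of `smashMul` reduces to the two rules for moving an element of
`A` past a product in `M` (`IsTwistedAction.actTensor_mul`, by the module property) and a product in
`A` past an element of `M` (`IsTwistedAction.mul_actTensor`, by the Cartan formula). The Leibniz
rule has to be checked only on products `a z`, `m n` and `m a`, where it comes from the formula for
`φ (b c)` and from the formula for `d (T c a)`. Finally `d_φ² = 0` is Brown's condition for `φ`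
transported along the coaction.
-/

noncomputable section

namespace TwistedTensor

/-! ### Signs and homogeneous elements -/

section Signs

/-- The sign `(-1)^n` as an element of the ground ring. -/
def ksign (R : Type*) [CommRing R] (n : ℤ) : R := ((n.negOnePow : ℤ) : R)

variable {R V W : Type*} [CommRing R] [AddCommGroup V] [Module R V] [AddCommGroup W] [Module R W]

theorem negOnePow_smul_eq (n : ℤ) (v : V) : n.negOnePow • v = ksign R n • v := by
  rw [Units.smul_def, ksign, Int.cast_smul_eq_zsmul]

@[simp] theorem ksign_zero : ksign R 0 = 1 := by simp [ksign]

@[simp] theorem ksign_one : ksign R 1 = -1 := by simp [ksign]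

theorem ksign_add (m n : ℤ) : ksign R (m + n) = ksign R m * ksign R n := by
  simp [ksign, Int.negOnePow_add]

theorem ksign_congr {m n : ℤ} (h : Even (m - n)) : ksign R m = ksign R n := by
  rw [ksign, ksign, (Int.negOnePow_eq_iff m n).2 h]

theorem ksign_mul_self (n : ℤ) : ksign R n * ksign R n = 1 := by
  rw [← ksign_add, ← ksign_zero (R := R)]
  exact ksign_congr (by simp)

theorem neg_ksign (n : ℤ) : -ksign R n = ksign R (n + 1) := by simp [ksign_add]

theorem Grading.signPow_of_mem (G : Grading R V) (n : ℤ) {i : ℤ} {v : V} (hv : v ∈ G.gr i) :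
    G.signPow n v = ksign R (n * i) • v := by
  rw [← negOnePow_smul_eq]
  simp [Grading.signPow, G.sum_of_mem _ hv]

theorem Grading.sgn_of_mem' (G : Grading R V) {i : ℤ} {v : V} (hv : v ∈ G.gr i) :
    G.sgn v = ksign R i • v := by
  rw [G.sgn_of_mem hv, negOnePow_smul_eq (R := R)]

theorem braid_tmul (G : Grading R V) (H : Grading R W) {i j : ℤ} {v : V} {w : W}
    (hv : v ∈ G.gr i) (hw : w ∈ H.gr j) :
    braid G H (v ⊗ₜ w) = ksign R (i * j) • (w ⊗ₜ[R] v) := by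
  rw [braid_of_mem G H hv hw, negOnePow_smul_eq (R := R)]

theorem Grading.induction (G : Grading R V) {p : V → Prop}
    (mem : ∀ i, ∀ v ∈ G.gr i, p v) (add : ∀ v w, p v → p w → p (v + w)) (v : V) : p v := by
  have h : v ∈ ⨆ i, G.gr i := by rw [G.internal.submodule_iSup_eq_top]; trivial
  exact Submodule.iSup_induction _ (motive := p) h mem (mem 0 0 (zero_mem _)) add

theorem Grading.hom_ext (G : Grading R V) {X : Type*} [AddCommMonoid X] [Module R X]
    {f g : V →ₗ[R] X} (h : ∀ i, ∀ v ∈ G.gr i, f v = g v) : f = g := by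
  ext v
  exact G.induction (p := fun v => f v = g v) h
    (fun v w h1 h2 => by rw [map_add, map_add, h1, h2]) v

theorem tensor_induction (G : Grading R V) (H : Grading R W) {p : V ⊗[R] W → Prop}
    (tmul : ∀ i, ∀ v ∈ G.gr i, ∀ j, ∀ w ∈ H.gr j, p (v ⊗ₜ w))
    (add : ∀ x y, p x → p y → p (x + y)) (x : V ⊗[R] W) : p x := by
  induction x with
  | zero => simpa using tmul 0 0 (zero_mem _) 0 0 (zero_mem _)
  | add x y h1 h2 => exact add x y h1 h2
  | tmul v w =>
    refine G.induction (p := fun v => p (v ⊗ₜ w)) (fun i v hv => ?_) (fun v v' h h' => ?_) v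
    · refine H.induction (p := fun w => p (v ⊗ₜ w)) (fun j w hw => tmul i v hv j w hw)
        (fun w w' h h' => ?_) w
      simpa [TensorProduct.tmul_add] using add _ _ h h'
    · simpa [TensorProduct.add_tmul] using add _ _ h h'

@[simp] theorem Grading.signPow_zero (G : Grading R V) : G.signPow 0 = LinearMap.id :=
  G.hom_ext fun i v hv => by simp [G.signPow_of_mem 0 hv]

theorem Grading.signPow_congr (G : Grading R V) {m n : ℤ} (h : Even (m - n)) :
    G.signPow m = G.signPow n :=
  G.hom_ext fun i v hv => by
    rw [G.signPow_of_mem m hv, G.signPow_of_mem n hv, ksign_congr (by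
      rw [← sub_mul]; exact h.mul_right i)]

theorem Grading.signPow_signPow (G : Grading R V) (m n : ℤ) (v : V) :
    G.signPow m (G.signPow n v) = G.signPow (m + n) v := by
  refine G.induction (p := fun v => G.signPow m (G.signPow n v) = G.signPow (m + n) v)
    (fun i v hv => ?_) (fun v w h h' => by simp only [map_add, h, h']) v
  rw [G.signPow_of_mem n hv, map_smul, G.signPow_of_mem m hv, G.signPow_of_mem _ hv, smul_smul,
    mul_comm, add_mul, ksign_add]

theorem Grading.signPow_mem (G : Grading R V) (n : ℤ) {i : ℤ} {v : V} (hv : v ∈ G.gr i) :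
    G.signPow n v ∈ G.gr i := by
  rw [G.signPow_of_mem n hv]; exact Submodule.smul_mem _ _ hv

theorem Grading.sgn_mem (G : Grading R V) {i : ℤ} {v : V} (hv : v ∈ G.gr i) :
    G.sgn v ∈ G.gr i := by
  rw [G.sgn_of_mem' hv]; exact Submodule.smul_mem _ _ hv

theorem Grading.sgn_sgn (G : Grading R V) (v : V) : G.sgn (G.sgn v) = v := by
  rw [Grading.sgn, G.signPow_signPow, G.signPow_congr (n := 0) (by decide), G.signPow_zero,
    LinearMap.id_apply]

/-- A linear map of degree `n` commutes with the sign involutions up to `(-1)^n`. -/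
theorem map_sgn_of_degree (G : Grading R V) (H : Grading R W) (f : V →ₗ[R] W) (n : ℤ)
    (hf : ∀ i, ∀ v ∈ G.gr i, f v ∈ H.gr (i + n)) (v : V) :
    f (G.sgn v) = ksign R n • H.sgn (f v) := by
  refine G.induction (p := fun v => f (G.sgn v) = ksign R n • H.sgn (f v)) (fun i v hv => ?_)
    (fun v w h h' => by rw [map_add, map_add, h, h', map_add, map_add, smul_add]) v
  rw [G.sgn_of_mem' hv, map_smul, H.sgn_of_mem' (hf i v hv), smul_smul, ksign_add,
    mul_comm (ksign R i), ← mul_assoc, ksign_mul_self, one_mul]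

theorem map_signPow_of_degree_zero (G : Grading R V) (H : Grading R W) (f : V →ₗ[R] W)
    (hf : ∀ i, ∀ v ∈ G.gr i, f v ∈ H.gr i) (n : ℤ) (v : V) :
    f (G.signPow n v) = H.signPow n (f v) := by
  refine G.induction (p := fun v => f (G.signPow n v) = H.signPow n (f v)) (fun i v hv => ?_)
    (fun v w h h' => by simp only [map_add, h, h']) v
  rw [G.signPow_of_mem n hv, map_smul, H.signPow_of_mem n (hf i v hv)]

theorem DGAlgebra.sgn_one (A : DGAlgebra R V) : A.sgn A.one = A.one := by
  rw [A.sgn_of_mem' A.one_mem, ksign_zero, one_smul]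

theorem DGAlgebra.sgn_mul (A : DGAlgebra R V) (v w : V) :
    A.sgn (A.mul v w) = A.mul (A.sgn v) (A.sgn w) := by
  induction v using A.toGrading.induction with
  | add x y h1 h2 => simp only [map_add, LinearMap.add_apply, h1, h2]
  | mem i v hv =>
    induction w using A.toGrading.induction with
    | add x y h1 h2 => simp only [map_add, h1, h2]
    | mem j w hw =>
      rw [A.sgn_of_mem' (A.mul_mem i j v hv w hw), A.sgn_of_mem' hv, A.sgn_of_mem' hw, ksign_add,
        map_smul, map_smul, LinearMap.smul_apply, smul_smul, mul_comm]

theorem DGAlgebra.d_mul (A : DGAlgebra R V) (v w : V) :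
    A.d (A.mul v w) = A.mul (A.d v) w + A.mul (A.sgn v) (A.d w) := by
  induction v using A.toGrading.induction with
  | add x y h1 h2 => simp only [map_add, LinearMap.add_apply, h1, h2]; abel
  | mem i v hv =>
    rw [A.leibniz i v hv, A.sgn_of_mem' hv, negOnePow_smul_eq (R := R), map_smul,
      LinearMap.smul_apply]

theorem DGAlgebra.d_sgn (A : DGAlgebra R V) (v : V) : A.d (A.sgn v) = -A.sgn (A.d v) := by
  rw [map_sgn_of_degree A.toGrading A.toGrading A.d 1 A.d_mem, ksign_one, neg_one_smul]

theorem DGAlgebra.d_one (A : DGAlgebra R V) : A.d A.one = 0 := by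
  have h := A.leibniz 0 A.one A.one_mem A.one
  rw [A.mul_one, A.mul_one, A.one_mul] at h
  simpa using h

end Signs

/-! ### The grading of a tensor product -/

section TensorGrading

variable {R V W : Type*} [CommRing R] [AddCommGroup V] [Module R V] [AddCommGroup W] [Module R W]

theorem tmul_mem_tensorGr {G : Grading R V} {H : Grading R W} {i j : ℤ} {v : V} {w : W}
    (hv : v ∈ G.gr i) (hw : w ∈ H.gr j) : v ⊗ₜ[R] w ∈ tensorGr G H (i + j) :=
  Submodule.subset_span ⟨i, j, v, hv, w, hw, rfl, rfl⟩

/-- An element of total degree `n` is a sum of tensors of homogeneous elements of total degree `n`;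
scalars are absorbed into the first factor. -/
theorem tensorGr_induction {G : Grading R V} {H : Grading R W} {n : ℤ} {p : V ⊗[R] W → Prop}
    (tmul : ∀ i, ∀ v ∈ G.gr i, ∀ j, ∀ w ∈ H.gr j, i + j = n → p (v ⊗ₜ w))
    (add : ∀ x y, p x → p y → p (x + y)) {x : V ⊗[R] W} (hx : x ∈ tensorGr G H n) : p x := by
  have hs : ∀ z ∈ {z : V ⊗[R] W | ∃ i j : ℤ, ∃ v ∈ G.gr i, ∃ w ∈ H.gr j, i + j = n ∧ z = v ⊗ₜ w},
      ∀ r : R, p (r • z) := by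
    rintro z ⟨i, j, v, hv, w, hw, hn, rfl⟩ r
    rw [TensorProduct.smul_tmul']
    exact tmul i _ (Submodule.smul_mem _ r hv) j w hw hn
  have h0 : p 0 := by
    simpa using tmul n 0 (zero_mem _) 0 0 (zero_mem _) (by simp)
  have key : ∀ x ∈ Submodule.span R {z : V ⊗[R] W | ∃ i j : ℤ, ∃ v ∈ G.gr i, ∃ w ∈ H.gr j,
      i + j = n ∧ z = v ⊗ₜ w}, ∀ r : R, p (r • x) := by
    intro x hx
    induction hx using Submodule.span_induction with
    | mem x hx => exact hs x hx
    | zero => intro r; simpa using h0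
    | add x y _ _ h1 h2 => intro r; rw [smul_add]; exact add _ _ (h1 r) (h2 r)
    | smul a x _ h => intro r; rw [smul_smul]; exact h _
  simpa using key x hx 1

/-- The decomposition of a tensor product of graded modules by total degree. -/
def tensorSplit (G : Grading R V) (H : Grading R W) :
    V ⊗[R] W →ₗ[R] ⨁ n, tensorGr G H n :=
  TensorProduct.lift (G.sum fun i => LinearMap.flip (H.sum fun j => LinearMap.flip
    (LinearMap.mk₂ R (fun (v : G.gr i) (w : H.gr j) =>
        DirectSum.lof R ℤ (fun n => tensorGr G H n) (i + j)
          ⟨(v : V) ⊗ₜ (w : W), tmul_mem_tensorGr v.2 w.2⟩)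
      (fun v v' w => by rw [← map_add]; congr 1; ext; simp [TensorProduct.add_tmul])
      (fun r v w => by rw [← map_smul]; congr 1)
      (fun v w w' => by rw [← map_add]; congr 1; ext; simp [TensorProduct.tmul_add])
      (fun r v w => by rw [← map_smul]; congr 1; ext; simp))))

theorem tensorSplit_tmul (G : Grading R V) (H : Grading R W) {i j : ℤ} {v : V} {w : W}
    (hv : v ∈ G.gr i) (hw : w ∈ H.gr j) :
    tensorSplit G H (v ⊗ₜ w) = DirectSum.lof R ℤ (fun n => tensorGr G H n) (i + j)
      ⟨v ⊗ₜ w, tmul_mem_tensorGr hv hw⟩ := by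
  simp [tensorSplit, G.sum_of_mem _ hv, H.sum_of_mem _ hw]

theorem tensorGr_isInternal (G : Grading R V) (H : Grading R W) :
    DirectSum.IsInternal (tensorGr G H) := by
  have key : ∀ n (x : V ⊗[R] W) (hx : x ∈ tensorGr G H n),
      tensorSplit G H x = DirectSum.lof R ℤ (fun n => tensorGr G H n) n ⟨x, hx⟩ := by
    intro n x hx
    refine (tensorGr_induction (p := fun x => ∃ h : x ∈ tensorGr G H n,
      tensorSplit G H x = DirectSum.lof R ℤ (fun n => tensorGr G H n) n ⟨x, h⟩) ?_ ?_ hx).2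
    · rintro i v hv j w hw rfl
      exact ⟨tmul_mem_tensorGr hv hw, tensorSplit_tmul G H hv hw⟩
    · rintro x y ⟨hx, ex⟩ ⟨hy, ey⟩
      exact ⟨add_mem hx hy, by rw [map_add, ex, ey, ← map_add]; rfl⟩
  refine ⟨?_, ?_⟩
  · refine Function.LeftInverse.injective (g := tensorSplit G H) fun z => ?_
    induction z using DirectSum.induction_on with
    | zero => simp
    | of n x => rw [DirectSum.coeAddMonoidHom_of]; exact key n x x.2
    | add x y h1 h2 => rw [map_add, map_add, h1, h2]
  · intro x
    induction x using tensor_induction G H with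
    | tmul i v hv j w hw =>
      exact ⟨DirectSum.of (fun n => tensorGr G H n) (i + j) ⟨_, tmul_mem_tensorGr hv hw⟩, by
        rw [DirectSum.coeAddMonoidHom_of]⟩
    | add x y h1 h2 =>
      obtain ⟨a, rfl⟩ := h1
      obtain ⟨b, rfl⟩ := h2
      exact ⟨a + b, map_add _ _ _⟩

/-- The total grading of a tensor product of graded modules. -/
def tensorGrading (G : Grading R V) (H : Grading R W) : Grading R (V ⊗[R] W) where
  gr := tensorGr G H
  internal := tensorGr_isInternal G H

theorem tensorGrading_signPow (G : Grading R V) (H : Grading R W) (n : ℤ) :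
    (tensorGrading G H).signPow n = TensorProduct.map (G.signPow n) (H.signPow n) := by
  refine LinearMap.ext fun x => ?_
  induction x using tensor_induction G H with
  | tmul i v hv j w hw =>
    rw [(tensorGrading G H).signPow_of_mem n (tmul_mem_tensorGr hv hw), TensorProduct.map_tmul,
      G.signPow_of_mem n hv, H.signPow_of_mem n hw, TensorProduct.smul_tmul_smul, mul_add,
      ksign_add]
  | add x y h1 h2 => rw [map_add, map_add, h1, h2]

theorem tensorGrading_sgn (G : Grading R V) (H : Grading R W) :
    (tensorGrading G H).sgn = TensorProduct.map G.sgn H.sgn := tensorGrading_signPow G H 1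

@[simp] theorem midSwap_tmul {X Y : Type*} [AddCommGroup X] [Module R X] [AddCommGroup Y]
    [Module R Y] (G : Grading R W) (H : Grading R X) {i j : ℤ} {w : W} {x : X} (v : V) (y : Y)
    (hw : w ∈ G.gr i) (hx : x ∈ H.gr j) :
    midSwap (V := V) (Y := Y) (braid G H) ((v ⊗ₜ w) ⊗ₜ (x ⊗ₜ y)) =
      ksign R (i * j) • ((v ⊗ₜ x) ⊗ₜ[R] (w ⊗ₜ y)) := by
  simp [midSwap, braid_tmul G H hw hx, ← TensorProduct.smul_tmul', TensorProduct.tmul_smul]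

end TensorGrading

/-! ### Comultiplicative extensions -/

section ToPos

variable {R V : Type*} [CommRing R] [AddCommGroup V] [Module R V] (A : DGAlgebra R V)

theorem toPos_of_pos {i : ℤ} (hi : 0 < i) {a : V} (ha : a ∈ A.gr i) :
    A.toPos a = Submodule.inclusion (A.gr_le_pos hi) ⟨a, ha⟩ := by
  rw [DGAlgebra.toPos, A.sum_of_mem _ ha, dif_pos hi]

theorem coe_toPos_of_pos {i : ℤ} (hi : 0 < i) {a : V} (ha : a ∈ A.gr i) :
    (A.toPos a : V) = a := by
  rw [toPos_of_pos A hi ha]; rfl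

theorem toPos_of_nonpos {i : ℤ} (hi : i ≤ 0) {a : V} (ha : a ∈ A.gr i) :
    A.toPos a = 0 := by
  rw [DGAlgebra.toPos, A.sum_of_mem _ ha, dif_neg (not_lt.2 hi), LinearMap.zero_apply]

theorem toPos_coe (a : A.pos) : A.toPos a = a := by
  induction a using pos_induction with
  | mem i hi a => exact toPos_of_pos A hi a.2
  | zero => simp
  | add a b h1 h2 => rw [Submodule.coe_add, map_add, h1, h2]

theorem letter_toPos_mem {i : ℤ} {a : V} (ha : a ∈ A.gr i) :
    letter A (A.toPos a) ∈ barGr A (i - 1) := by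
  rcases lt_or_ge 0 i with hi | hi
  · rw [toPos_of_pos A hi ha]; exact letter_mem A hi ⟨a, ha⟩
  · rw [toPos_of_nonpos A hi ha, map_zero]; exact zero_mem _

@[simp] theorem barCounit_one : barCounit A 1 = 1 := by simp [barCounit]

@[simp] theorem barCounit_cons (a : A.pos) (x : Bar A) :
    barCounit A (letter A a * x) = 0 := by
  simp [barCounit, letter, TensorAlgebra.algebraMapInv]

@[simp] theorem barCounit_letter (a : A.pos) : barCounit A (letter A a) = 0 := by
  simpa using barCounit_cons A a 1

/-- The projection of `BA` onto the words of length one, `[a] ↦ a`. -/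
def barHead : Bar A →ₗ[R] A.pos :=
  barRec A 0 ((LinearMap.lsmul R A.pos ∘ₗ barCounit A).flip) 0

@[simp] theorem barHead_one : barHead A 1 = 0 := barRec_one _ _ _ _

@[simp] theorem barHead_cons (a : A.pos) (x : Bar A) :
    barHead A (letter A a * x) = barCounit A x • a := by
  simp [barHead, barRec_cons]

@[simp] theorem barHead_letter (a : A.pos) : barHead A (letter A a) = a := by
  simpa using barHead_cons A a 1

end ToPos

section Ext

variable {R V D : Type*} [CommRing R] [AddCommGroup V] [Module R V] [AddCommGroup D] [Module R D]

/-- The comultiplication `Δ` of the non-negatively graded module `D` has degree `0`, and `f`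
vanishes in degree `0`. This makes the comultiplicative extension of `f` a finite sum. -/
structure IsReducedCochain (G : Grading R D) (Δ : D →ₗ[R] D ⊗[R] D) (f : D →ₗ[R] V) : Prop where
  neg : ∀ i < 0, G.gr i = ⊥
  comul_mem : ∀ n, ∀ c ∈ G.gr n, Δ c ∈ tensorGr G G n
  map_zero : ∀ c ∈ G.gr 0, f c = 0

variable {A : DGAlgebra R V} {G : Grading R D} {Δ : D →ₗ[R] D ⊗[R] D} {ε : D →ₗ[R] R}
  {f : D →ₗ[R] V}

theorem extTerm_eq_zero (hf : IsReducedCochain G Δ f) (k : ℕ) :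
    ∀ (n : ℤ), n < k → ∀ c ∈ G.gr n, extTerm Δ ε A f k c = 0 := by
  induction k with
  | zero =>
    intro n hn c hc
    rw [hf.neg n (by simpa using hn), Submodule.mem_bot] at hc
    rw [hc, map_zero]
  | succ k ih =>
    intro n hn c hc
    simp only [extTerm, LinearMap.comp_apply]
    refine tensorGr_induction (p := fun z => LinearMap.mul' R (Bar A) (TensorProduct.map
      (letter A ∘ₗ A.toPos ∘ₗ f) (extTerm Δ ε A f k) z) = 0) ?_ ?_ (hf.comul_mem n c hc)
    · -- `f v` vanishes unless `v` has positive degree, and then `w` has degree less than `n`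
      intro i v hv j w hw hij
      simp only [TensorProduct.map_tmul, LinearMap.mul'_apply, LinearMap.comp_apply]
      rcases lt_trichotomy i 0 with hi | rfl | hi
      · rw [hf.neg i hi, Submodule.mem_bot] at hv
        simp [hv]
      · simp [hf.map_zero v hv]
      · rw [ih j (by push_cast at hn; omega) w hw, mul_zero]
    · intro x y hx hy
      rw [map_add, map_add, hx, hy, add_zero]

theorem extTerm_eventually_zero (hf : IsReducedCochain G Δ f) (x : D) :
    ∃ N : ℕ, ∀ k ≥ N, extTerm Δ ε A f k x = 0 := by
  induction x using G.induction with
  | mem n c hc =>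
    exact ⟨(n + 1).toNat, fun k hk => extTerm_eq_zero hf k n (by omega) c hc⟩
  | add x y hx hy =>
    obtain ⟨N, hN⟩ := hx
    obtain ⟨N', hN'⟩ := hy
    refine ⟨max N N', fun k hk => ?_⟩
    rw [map_add, hN k (le_of_max_le_left hk), hN' k (le_of_max_le_right hk), add_zero]

/-- A sequence whose partial sums become stationary has finite support, and its sum is the
stationary value. -/
theorem finsum_eq_of_eventually {X : Type*} [AddCommGroup X] {g : ℕ → X} {s : X}
    (h : ∀ᶠ N in Filter.atTop, ∑ k ∈ Finset.range N, g k = s) :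
    (Function.support g).Finite ∧ ∑ᶠ k, g k = s := by
  obtain ⟨N, hN⟩ := Filter.eventually_atTop.1 h
  have hs : Function.support g ⊆ Finset.range N := by
    intro k hk
    by_contra hkN
    have hkN : N ≤ k := by simpa using hkN
    have h1 := hN (k + 1) (by omega)
    rw [Finset.sum_range_succ, hN k hkN] at h1
    exact hk (by simpa using h1)
  exact ⟨(Finset.finite_toSet _).subset hs, by
    rw [finsum_eq_sum_of_support_subset g hs, hN N le_rfl]⟩

/-- The comultiplicative extension as an eventually stationary limit of partial sums. -/
theorem comulExt_eventually (hf : IsReducedCochain G Δ f) (x : D) :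
    ∀ᶠ N in Filter.atTop, ∑ k ∈ Finset.range N, extTerm Δ ε A f k x = comulExt Δ ε A f x := by
  have hfin : ∀ x, (Function.support fun k => extTerm Δ ε A f k x).Finite := fun x => by
    obtain ⟨N, hN⟩ := extTerm_eventually_zero (ε := ε) (A := A) hf x
    refine (Set.finite_lt_nat N).subset fun k hk => ?_
    by_contra h
    exact hk (hN k (not_lt.1 h))
  obtain ⟨N, hN⟩ := extTerm_eventually_zero (ε := ε) (A := A) hf x
  refine Filter.eventually_atTop.2 ⟨N, fun M hM => ?_⟩
  rw [comulExt, dif_pos hfin]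
  refine (finsum_eq_sum_of_support_subset _ fun k hk => ?_).symm
  by_contra h
  exact hk (hN k (hM.trans (by simpa using h)))

/-- `x ↦ [f x]`. -/
def letterMap (A : DGAlgebra R V) (f : D →ₗ[R] V) : D →ₗ[R] Bar A := letter A ∘ₗ A.toPos ∘ₗ f

@[simp] theorem letterMap_apply (x : D) : letterMap A f x = letter A (A.toPos (f x)) := rfl

/-- The comultiplicative extension `g` of `f` satisfies `g x = ε x + ∑ [f x⁽¹⁾] g x⁽²⁾`. -/
theorem comulExt_rec (hf : IsReducedCochain G Δ f) (x : D) :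
    comulExt Δ ε A f x = ε x • 1 +
      LinearMap.mul' R (Bar A) (TensorProduct.map (letterMap A f) (comulExt Δ ε A f) (Δ x)) := by
  have key : ∀ z : D ⊗[R] D, ∀ᶠ N in Filter.atTop,
      ∑ k ∈ Finset.range N, LinearMap.mul' R (Bar A)
        (TensorProduct.map (letterMap A f) (extTerm Δ ε A f k) z) =
      LinearMap.mul' R (Bar A) (TensorProduct.map (letterMap A f) (comulExt Δ ε A f) z) := by
    intro z
    induction z with
    | zero => simp
    | add z z' h h' =>
      filter_upwards [h, h'] with N h h'
      simp only [map_add, Finset.sum_add_distrib, h, h']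
    | tmul v w =>
      filter_upwards [comulExt_eventually (ε := ε) (A := A) hf w] with N hN
      simp only [TensorProduct.map_tmul, LinearMap.mul'_apply, ← Finset.mul_sum, hN]
  obtain ⟨N, h1, h2⟩ := ((key (Δ x)).and ((Filter.tendsto_add_atTop_nat 1).eventually
    (comulExt_eventually (ε := ε) (A := A) hf x))).exists
  rw [← h2, Finset.sum_range_succ', add_comm, ← h1]
  congr 1
  simp [extTerm, Algebra.algebraMap_eq_smul_one]

theorem barCounit_comulExt (hf : IsReducedCochain G Δ f) (x : D) :
    barCounit A (comulExt Δ ε A f x) = ε x := by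
  have key : ∀ z : D ⊗[R] D, barCounit A (LinearMap.mul' R (Bar A)
      (TensorProduct.map (letterMap A f) (comulExt Δ ε A f) z)) = 0 := by
    intro z
    induction z with
    | zero => simp
    | add z z' h h' => simp only [map_add, h, h', add_zero]
    | tmul v w => simp
  rw [comulExt_rec hf, map_add, key]
  simp

/-- The component of length one of the comultiplicative extension of `f` is `f`. -/
theorem barHead_comulExt (hf : IsReducedCochain G Δ f)
    (hε : ∀ x, TensorProduct.rid R D (LinearMap.lTensor D ε (Δ x)) = x) (x : D) :
    barHead A (comulExt Δ ε A f x) = A.toPos (f x) := by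
  have key : ∀ z : D ⊗[R] D, barHead A (LinearMap.mul' R (Bar A)
      (TensorProduct.map (letterMap A f) (comulExt Δ ε A f) z)) =
      A.toPos (f (TensorProduct.rid R D (LinearMap.lTensor D ε z))) := by
    intro z
    induction z with
    | zero => simp
    | add z z' h h' => simp only [map_add, h, h']
    | tmul v w => simp [barCounit_comulExt hf]
  rw [comulExt_rec hf, map_add, key, hε]
  simp

theorem comulExt_mem (hf : IsReducedCochain G Δ f)
    (hdeg : ∀ n, ∀ c ∈ G.gr n, f c ∈ A.gr (n + 1)) (hε : ∀ n ≠ 0, ∀ c ∈ G.gr n, ε c = 0)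
    {n : ℤ} {c : D} (hc : c ∈ G.gr n) : comulExt Δ ε A f c ∈ barGr A n := by
  have key : ∀ k : ℕ, ∀ n, ∀ c ∈ G.gr n, extTerm Δ ε A f k c ∈ barGr A n := by
    intro k
    induction k with
    | zero =>
      intro n c hc
      by_cases hn : n = 0
      · subst hn
        simp only [extTerm, LinearMap.comp_apply, Algebra.linearMap_apply,
          Algebra.algebraMap_eq_smul_one]
        exact Submodule.smul_mem _ _ SetLike.GradedOne.one_mem
      · simp [extTerm, hε n hn c hc]
    | succ k ih =>
      intro n c hc
      simp only [extTerm, LinearMap.comp_apply]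
      refine tensorGr_induction (p := fun z => LinearMap.mul' R (Bar A) (TensorProduct.map
        (letter A ∘ₗ A.toPos ∘ₗ f) (extTerm Δ ε A f k) z) ∈ barGr A n) ?_ ?_ (hf.comul_mem n c hc)
      · rintro i v hv j w hw rfl
        have h := letter_toPos_mem A (hdeg i v hv)
        rw [add_sub_cancel_right] at h
        exact SetLike.GradedMul.mul_mem h (ih j w hw)
      · intro x y hx hy
        rw [map_add, map_add]
        exact add_mem hx hy
  obtain ⟨N, hN⟩ := (comulExt_eventually (ε := ε) (A := A) hf c).exists
  rw [← hN]
  exact sum_mem fun k _ => key k n c hc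

/-- A linear map `h` with `h x = ∑ Φ (x⁽¹⁾ ⊗ h x⁽²⁾)`, where `Φ` kills `x⁽¹⁾` of degree `0`,
vanishes by induction on the degree. Applied to the difference of two maps, it shows that they
agree if they satisfy the same recursion. -/
theorem eq_zero_of_rec {X : Type*} [AddCommGroup X] [Module R X] (hf : IsReducedCochain G Δ f)
    (Φ : D ⊗[R] X →ₗ[R] X) (hΦ : ∀ v ∈ G.gr 0, ∀ x, Φ (v ⊗ₜ x) = 0) (h : D →ₗ[R] X)
    (hh : ∀ x, h x = Φ (LinearMap.lTensor D h (Δ x))) : h = 0 := by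
  have key : ∀ k : ℕ, ∀ n : ℤ, n < k → ∀ c ∈ G.gr n, h c = 0 := by
    intro k
    induction k with
    | zero =>
      intro n hn c hc
      rw [hf.neg n (by simpa using hn), Submodule.mem_bot] at hc
      rw [hc, map_zero]
    | succ k ih =>
      intro n hn c hc
      rw [hh]
      refine tensorGr_induction (p := fun z => Φ (LinearMap.lTensor D h z) = 0) ?_ ?_
        (hf.comul_mem n c hc)
      · intro i v hv j w hw hij
        rw [LinearMap.lTensor_tmul]
        rcases lt_trichotomy i 0 with hi | rfl | hi
        · rw [hf.neg i hi, Submodule.mem_bot] at hv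
          simp [hv]
        · exact hΦ v hv _
        · rw [ih j (by push_cast at hn; omega) w hw, TensorProduct.tmul_zero, map_zero]
      · intro x y hx hy
        rw [map_add, map_add, hx, hy, add_zero]
  refine G.hom_ext fun n c hc => ?_
  rw [key (n + 1).toNat n (by omega) c hc, LinearMap.zero_apply]

/-- The comultiplicative extension is a map of coalgebras. -/
theorem deconc_comulExt (hf : IsReducedCochain G Δ f)
    (coassoc : ∀ c, TensorProduct.assoc R D D D (LinearMap.rTensor D Δ (Δ c)) =
      LinearMap.lTensor D Δ (Δ c))
    (hε : ∀ x, TensorProduct.lid R D (LinearMap.rTensor D ε (Δ x)) = x) (x : D) :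
    deconc A (comulExt Δ ε A f x) =
      TensorProduct.map (comulExt Δ ε A f) (comulExt Δ ε A f) (Δ x) := by
  set g := comulExt Δ ε A f with hg
  -- both sides satisfy `h x = 1 ⊗ g x + ∑ ([f x⁽¹⁾] ⊗ 1) h x⁽²⁾`, where `g` is the extension
  let Φ : D ⊗[R] (Bar A ⊗[R] Bar A) →ₗ[R] Bar A ⊗[R] Bar A :=
    TensorProduct.lift (LinearMap.rTensorHom (Bar A) ∘ₗ LinearMap.mul R (Bar A) ∘ₗ letterMap A f)
  have e1 : ∀ x, deconc A (g x) = 1 ⊗ₜ g x + Φ (LinearMap.lTensor D (deconc A ∘ₗ g) (Δ x)) := by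
    intro x
    have key : ∀ z : D ⊗[R] D, deconc A (LinearMap.mul' R (Bar A)
        (TensorProduct.map (letterMap A f) g z)) =
        1 ⊗ₜ LinearMap.mul' R (Bar A) (TensorProduct.map (letterMap A f) g z) +
          Φ (LinearMap.lTensor D (deconc A ∘ₗ g) z) := by
      intro z
      induction z with
      | zero => simp
      | add z z' h h' => simp only [map_add, h, h', TensorProduct.tmul_add]; abel
      | tmul v w =>
        simp only [TensorProduct.map_tmul, LinearMap.mul'_apply, letterMap_apply, deconc_cons]
        rfl
    rw [hg, comulExt_rec hf, ← hg, map_add, key, map_smul, deconc_one, TensorProduct.tmul_add,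
      TensorProduct.tmul_smul, add_assoc]
  have e2 : ∀ x, TensorProduct.map g g (Δ x) =
      1 ⊗ₜ g x + Φ (LinearMap.lTensor D (TensorProduct.map g g ∘ₗ Δ) (Δ x)) := by
    intro x
    have key : ∀ z : D ⊗[R] D, TensorProduct.map g g z =
        1 ⊗ₜ g (TensorProduct.lid R D (LinearMap.rTensor D ε z)) +
          Φ (LinearMap.lTensor D (TensorProduct.map g g)
            (TensorProduct.assoc R D D D (LinearMap.rTensor D Δ z))) := by
      intro z
      induction z with
      | zero => simp
      | add z z' h h' =>
        rw [map_add, h, h']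
        simp only [map_add, TensorProduct.tmul_add]; abel
      | tmul v w =>
        have key' : ∀ y : D ⊗[R] D,
            LinearMap.mul' R (Bar A) (TensorProduct.map (letterMap A f) g y) ⊗ₜ[R] g w =
            Φ (LinearMap.lTensor D (TensorProduct.map g g)
              (TensorProduct.assoc R D D D (y ⊗ₜ w))) := by
          intro y
          induction y with
          | zero => simp
          | add y y' h h' => simp only [map_add, TensorProduct.add_tmul, h, h']
          | tmul u v => simp [Φ]
        rw [TensorProduct.map_tmul]
        nth_rw 1 [hg]
        rw [comulExt_rec hf, ← hg, TensorProduct.add_tmul, key']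
        simp [TensorProduct.smul_tmul]
    rw [key, hε, coassoc, LinearMap.lTensor_comp, LinearMap.comp_apply]
  have h := eq_zero_of_rec hf Φ (fun v hv x => by simp [Φ, hf.map_zero v hv])
    (deconc A ∘ₗ g - TensorProduct.map g g ∘ₗ Δ) (fun x => by
      rw [LinearMap.sub_apply, LinearMap.comp_apply, LinearMap.comp_apply, e1, e2,
        LinearMap.lTensor_sub, LinearMap.sub_apply, map_sub]
      abel)
  exact sub_eq_zero.1 (LinearMap.congr_fun h x)

/-- The comultiplicative extension of a twisting cochain is a chain map. -/
theorem barD_comulExt (hf : IsReducedCochain G Δ f)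
    (hdeg : ∀ n, ∀ c ∈ G.gr n, f c ∈ A.gr (n + 1))
    (coassoc : ∀ c, TensorProduct.assoc R D D D (LinearMap.rTensor D Δ (Δ c)) =
      LinearMap.lTensor D Δ (Δ c))
    {d : D →ₗ[R] D} (comul_d : ∀ c, Δ (d c) = tensorD G d d (Δ c)) (hεd : ∀ c, ε (d c) = 0)
    (brown : BrownCondition G.sgn d Δ A f) (x : D) :
    barD A (comulExt Δ ε A f x) = comulExt Δ ε A f (d x) := by
  -- nothing is lost when `f v` is regarded as an element of `A_{>0}`
  have hpos : ∀ v, (A.toPos (f v) : V) = f v := fun v => by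
    induction v using G.induction with
    | mem n c hc =>
      rcases lt_trichotomy n 0 with hn | rfl | hn
      · rw [hf.neg n hn, Submodule.mem_bot] at hc
        simp [hc]
      · simp [hf.map_zero c hc]
      · exact coe_toPos_of_pos A (by omega) (hdeg n c hc)
    | add v w h h' => simp only [map_add, Submodule.coe_add, h, h']
  have hsgn : ∀ v, barSgn A (A.toPos (f v)) = A.toPos (f (G.sgn v)) := fun v => by
    rw [map_sgn_of_degree G A.toGrading f 1 hdeg, ksign_one]
    simp [barSgn, hpos]
  set g := comulExt Δ ε A f with hg
  let Φ : D ⊗[R] Bar A →ₗ[R] Bar A :=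
    TensorProduct.lift (LinearMap.mul R (Bar A) ∘ₗ letterMap A (f ∘ₗ G.sgn))
  -- the terms in which two neighbouring letters are multiplied
  let Q : D ⊗[R] D →ₗ[R] V := TensorProduct.lift A.mul ∘ₗ TensorProduct.map (f ∘ₗ G.sgn) f
  have e1 : ∀ x, barD A (g x) = -LinearMap.mul' R (Bar A)
      (TensorProduct.map (letterMap A (A.d ∘ₗ f)) g (Δ x)) -
      LinearMap.mul' R (Bar A) (TensorProduct.map (letterMap A (Q ∘ₗ Δ)) g (Δ x)) +
      Φ (LinearMap.lTensor D (barD A ∘ₗ g) (Δ x)) := by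
    intro x
    have key : ∀ z : D ⊗[R] D, barD A (LinearMap.mul' R (Bar A)
        (TensorProduct.map (letterMap A f) g z)) =
        -LinearMap.mul' R (Bar A) (TensorProduct.map (letterMap A (A.d ∘ₗ f)) g z) -
        LinearMap.mul' R (Bar A) (TensorProduct.map (letterMap A Q) g
          ((TensorProduct.assoc R D D D).symm (LinearMap.lTensor D Δ z))) +
        Φ (LinearMap.lTensor D (barD A ∘ₗ g) z) := by
      intro z
      induction z with
      | zero => simp
      | add z z' h h' => simp only [map_add, h, h']; abel
      | tmul v w =>
        have key' : ∀ y : D ⊗[R] D, merge A (LinearMap.mul' R (Bar A)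
            (TensorProduct.map (letterMap A f) g y)) (A.toPos (f (G.sgn v))) =
            LinearMap.mul' R (Bar A) (TensorProduct.map (letterMap A Q) g
              ((TensorProduct.assoc R D D D).symm (v ⊗ₜ y))) := by
          intro y
          induction y with
          | zero => simp
          | add y y' h h' => simp only [map_add, LinearMap.add_apply, TensorProduct.tmul_add, h, h']
          | tmul u w => simp [Q, merge_cons, hpos]
        have hm : merge A (g w) (A.toPos (f (G.sgn v))) =
            LinearMap.mul' R (Bar A) (TensorProduct.map (letterMap A Q) g
              ((TensorProduct.assoc R D D D).symm (v ⊗ₜ Δ w))) := by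
          rw [← key', hg, comulExt_rec hf, ← hg, map_add, map_smul, LinearMap.add_apply,
            LinearMap.smul_apply, merge_one, smul_zero, zero_add]
        simp only [TensorProduct.map_tmul, LinearMap.mul'_apply, letterMap_apply, barD_cons,
          LinearMap.lTensor_tmul, hsgn, hm, hpos, LinearMap.comp_apply, Φ, TensorProduct.lift.tmul,
          LinearMap.mul_apply']
    rw [hg, comulExt_rec hf, ← hg, map_add, key, map_smul, barD_one, smul_zero, zero_add,
      ← coassoc, LinearEquiv.symm_apply_apply, LinearMap.map_rTensor]
    rfl
  have e2 : ∀ x, g (d x) = LinearMap.mul' R (Bar A)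
      (TensorProduct.map (letterMap A (f ∘ₗ d)) g (Δ x)) +
      Φ (LinearMap.lTensor D (g ∘ₗ d) (Δ x)) := by
    intro x
    have key : ∀ z : D ⊗[R] D, LinearMap.mul' R (Bar A)
        (TensorProduct.map (letterMap A f) g (tensorD G d d z)) =
        LinearMap.mul' R (Bar A) (TensorProduct.map (letterMap A (f ∘ₗ d)) g z) +
        Φ (LinearMap.lTensor D (g ∘ₗ d) z) := by
      intro z
      induction z with
      | zero => simp
      | add z z' h h' => simp only [map_add, h, h']; abel
      | tmul v w => simp [tensorD, Φ]
    rw [hg, comulExt_rec hf, ← hg, comul_d, key, hεd, zero_smul, zero_add]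
  -- Brown's condition
  have e3 : letterMap A (A.d ∘ₗ f) + letterMap A (Q ∘ₗ Δ) + letterMap A (f ∘ₗ d) = 0 := by
    ext v
    have h := brown v
    simp only [LinearMap.add_apply, letterMap_apply, LinearMap.comp_apply, ← map_add,
      LinearMap.zero_apply, Q]
    rw [add_right_comm, h, neg_add_cancel, map_zero, map_zero]
  have h := eq_zero_of_rec hf Φ (fun v hv x => by
      simp [Φ, hf.map_zero _ (G.sgn_mem hv)])
    (barD A ∘ₗ g - g ∘ₗ d) (fun x => by
      have h3 : LinearMap.mul' R (Bar A) (TensorProduct.map (letterMap A (A.d ∘ₗ f) +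
        letterMap A (Q ∘ₗ Δ) + letterMap A (f ∘ₗ d)) g (Δ x)) = 0 := by
        rw [e3, TensorProduct.map_zero_left, LinearMap.zero_apply, map_zero]
      simp only [TensorProduct.map_add_left, LinearMap.add_apply, map_add] at h3
      rw [LinearMap.sub_apply, LinearMap.comp_apply, LinearMap.comp_apply, e1, e2,
        LinearMap.lTensor_sub, LinearMap.sub_apply, map_sub, ← sub_eq_zero, ← neg_eq_zero]
      rw [← h3]
      abel)
  exact sub_eq_zero.1 (LinearMap.congr_fun h x)

end Ext

/-! ### The coalgebra `BA` -/

section BarCoalgebra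

variable {R V : Type*} [CommRing R] [AddCommGroup V] [Module R V] (A : DGAlgebra R V)

theorem word_cons (a : A.pos) (l : List A.pos) : word A (a :: l) = letter A a * word A l := by
  simp [word]

theorem span_range_word : Submodule.span R (Set.range (word A)) = ⊤ := by
  have key : ∀ x : Bar A, ∀ y ∈ Submodule.span R (Set.range (word A)),
      x * y ∈ Submodule.span R (Set.range (word A)) := by
    intro x
    induction x using TensorAlgebra.induction with
    | algebraMap r =>
      intro y hy
      rw [Algebra.algebraMap_eq_smul_one, smul_mul_assoc, one_mul]
      exact Submodule.smul_mem _ _ hy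
    | ι a =>
      intro y hy
      induction hy using Submodule.span_induction with
      | mem y hy =>
        obtain ⟨l, rfl⟩ := hy
        exact Submodule.subset_span ⟨a :: l, word_cons A a l⟩
      | zero => simp
      | add y z _ _ h1 h2 => rw [mul_add]; exact add_mem h1 h2
      | smul r y _ h => rw [mul_smul_comm]; exact Submodule.smul_mem _ _ h
    | mul a b h1 h2 => intro y hy; rw [mul_assoc]; exact h1 _ (h2 _ hy)
    | add a b h1 h2 => intro y hy; rw [add_mul]; exact add_mem (h1 _ hy) (h2 _ hy)
  refine eq_top_iff.2 fun x _ => ?_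
  rw [← mul_one x]
  exact key x 1 (Submodule.subset_span ⟨[], by simp [word]⟩)

theorem bar_hom_ext {X : Type*} [AddCommGroup X] [Module R X] {f g : Bar A →ₗ[R] X}
    (h : ∀ l, f (word A l) = g (word A l)) : f = g :=
  LinearMap.ext_on_range (span_range_word A) h

theorem barCounit_of_ne {n : ℤ} (hn : n ≠ 0) {x : Bar A} (hx : x ∈ barGr A n) :
    barCounit A x = 0 := by
  suffices h : barGr A n ≤ LinearMap.ker (barCounit A) from h hx
  refine Submodule.span_le.2 ?_
  rintro _ ⟨l, hl, rfl⟩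
  cases l with
  | nil => exact absurd hl.symm (by simpa using hn)
  | cons p l => simp [word_cons]

theorem barCounit_signPow (i : ℤ) (x : Bar A) :
    barCounit A ((barGrading A).signPow i x) = barCounit A x := by
  induction x using (barGrading A).induction with
  | mem n x hx =>
    rw [(barGrading A).signPow_of_mem i hx, map_smul]
    by_cases hn : n = 0
    · simp [hn]
    · rw [barCounit_of_ne A hn hx, smul_zero]
  | add x y h1 h2 => simp only [map_add, h1, h2]

theorem deconc_letter (a : A.pos) :
    deconc A (letter A a) = 1 ⊗ₜ letter A a + letter A a ⊗ₜ 1 := by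
  have h := deconc_cons A a 1
  rw [mul_one, deconc_one] at h
  simpa using h

theorem deconc_mem {n : ℤ} {x : Bar A} (hx : x ∈ barGr A n) :
    deconc A x ∈ tensorGr (barGrading A) (barGrading A) n := by
  suffices h : barGr A n ≤ (tensorGr (barGrading A) (barGrading A) n).comap (deconc A) from h hx
  refine Submodule.span_le.2 ?_
  rintro _ ⟨l, rfl, rfl⟩
  rw [SetLike.mem_coe, Submodule.mem_comap]
  clear hx
  have h1 : (1 : Bar A) ∈ (barGrading A).gr 0 := (barGr_gradedMonoid A).one_mem
  induction l with
  | nil =>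
    simp only [word, List.map_nil, List.prod_nil, List.sum_nil, deconc_one]
    simpa using tmul_mem_tensorGr h1 h1
  | cons p l ih =>
    have hm : word A ((p :: l).map fun p => Submodule.inclusion (A.gr_le_pos p.1.2) p.2) ∈
        (barGrading A).gr ((p :: l).map fun p => p.1.1 - 1).sum :=
      Submodule.subset_span ⟨p :: l, rfl, rfl⟩
    simp only [List.map_cons, word_cons, List.sum_cons] at hm ⊢
    rw [deconc_cons]
    refine add_mem ?_ ?_
    · simpa using tmul_mem_tensorGr h1 hm
    · refine tensorGr_induction (p := fun z => LinearMap.rTensor (Bar A) (LinearMap.mulLeft R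
        (letter A (Submodule.inclusion (A.gr_le_pos p.1.2) p.2))) z ∈ _) ?_ ?_ ih
      · intro i v hv j w hw hij
        have h := (barGr_gradedMonoid A).mul_mem (letter_mem A p.1.2 p.2) hv
        have h' := tmul_mem_tensorGr (G := barGrading A) (H := barGrading A) h hw
        rw [← hij, ← add_assoc]
        exact h'
      · intro x y hx hy
        rw [map_add]
        exact add_mem hx hy

theorem deconc_sgn (x : Bar A) : deconc A ((barGrading A).sgn x) =
    TensorProduct.map (barGrading A).sgn (barGrading A).sgn (deconc A x) := by
  rw [map_sgn_of_degree (barGrading A) (tensorGrading (barGrading A) (barGrading A)) (deconc A) 0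
    (fun i x hx => by rw [add_zero]; exact deconc_mem A hx), tensorGrading_sgn, ksign_zero,
    one_smul]

theorem deconc_counit (x : Bar A) :
    TensorProduct.rid R (Bar A) (LinearMap.lTensor (Bar A) (barCounit A) (deconc A x)) = x := by
  have key : ∀ a, ∀ z : Bar A ⊗[R] Bar A, TensorProduct.rid R (Bar A) (LinearMap.lTensor (Bar A)
      (barCounit A) (LinearMap.rTensor (Bar A) (LinearMap.mulLeft R (letter A a)) z)) =
      letter A a * TensorProduct.rid R (Bar A) (LinearMap.lTensor (Bar A) (barCounit A) z) := by
    intro a z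
    induction z with
    | zero => simp
    | add x y h1 h2 => simp only [map_add, h1, h2, mul_add]
    | tmul x y => simp
  suffices h : (TensorProduct.rid R (Bar A)).toLinearMap ∘ₗ
      LinearMap.lTensor (Bar A) (barCounit A) ∘ₗ deconc A = LinearMap.id from
    LinearMap.congr_fun h x
  refine bar_hom_ext A fun l => ?_
  induction l with
  | nil => simp [word, deconc_one]
  | cons a l ih =>
    simp only [LinearMap.comp_apply, LinearEquiv.coe_coe, LinearMap.id_apply] at ih ⊢
    rw [word_cons, deconc_cons, map_add, map_add, key, ih]
    simp

theorem counit_deconc (x : Bar A) :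
    TensorProduct.lid R (Bar A) (LinearMap.rTensor (Bar A) (barCounit A) (deconc A x)) = x := by
  have key : ∀ a, ∀ z : Bar A ⊗[R] Bar A, LinearMap.rTensor (Bar A)
      (barCounit A) (LinearMap.rTensor (Bar A) (LinearMap.mulLeft R (letter A a)) z) = 0 := by
    intro a z
    induction z with
    | zero => simp
    | add x y h1 h2 => simp only [map_add, h1, h2, add_zero]
    | tmul x y => simp
  suffices h : (TensorProduct.lid R (Bar A)).toLinearMap ∘ₗ
      LinearMap.rTensor (Bar A) (barCounit A) ∘ₗ deconc A = LinearMap.id from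
    LinearMap.congr_fun h x
  refine bar_hom_ext A fun l => ?_
  cases l with
  | nil => simp [word, deconc_one]
  | cons a l =>
    simp only [LinearMap.comp_apply, LinearEquiv.coe_coe, LinearMap.id_apply]
    rw [word_cons, deconc_cons, map_add, map_add, key]
    simp

theorem midSwap_mem {i j : ℤ} {y z : Bar A ⊗[R] Bar A}
    (hy : y ∈ tensorGr (barGrading A) (barGrading A) i)
    (hz : z ∈ tensorGr (barGrading A) (barGrading A) j) :
    midSwap (braid (barGrading A) (barGrading A)) (y ⊗ₜ z) ∈
      tensorGr (tensorGrading (barGrading A) (barGrading A))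
        (tensorGrading (barGrading A) (barGrading A)) (i + j) := by
  refine tensorGr_induction (p := fun y => midSwap (braid (barGrading A) (barGrading A))
    (y ⊗ₜ z) ∈ _) ?_ ?_ hy
  · intro k v hv l w hw hkl
    refine tensorGr_induction (p := fun z => midSwap (braid (barGrading A) (barGrading A))
      ((v ⊗ₜ w) ⊗ₜ z) ∈ _) ?_ ?_ hz
    · intro k' v' hv' l' w' hw' hkl'
      rw [midSwap_tmul _ _ _ _ hw hv']
      refine Submodule.smul_mem _ _ ?_
      have h := tmul_mem_tensorGr (G := tensorGrading (barGrading A) (barGrading A))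
        (H := tensorGrading (barGrading A) (barGrading A))
        (tmul_mem_tensorGr hv hv') (tmul_mem_tensorGr hw hw')
      rwa [show i + j = k + k' + (l + l') by omega]
    · intro x y h1 h2
      rw [TensorProduct.tmul_add, map_add]
      exact add_mem h1 h2
  · intro x y h1 h2
    rw [TensorProduct.add_tmul, map_add]
    exact add_mem h1 h2

theorem barTensorComul_mem {n : ℤ} {z : Bar A ⊗[R] Bar A}
    (hz : z ∈ tensorGr (barGrading A) (barGrading A) n) :
    barTensorComul A z ∈ tensorGr (tensorGrading (barGrading A) (barGrading A))
        (tensorGrading (barGrading A) (barGrading A)) n := by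
  refine tensorGr_induction (p := fun z => barTensorComul A z ∈ _) ?_ ?_ hz
  · rintro i v hv j w hw rfl
    exact midSwap_mem A (deconc_mem A hv) (deconc_mem A hw)
  · intro x y h1 h2
    rw [map_add]
    exact add_mem h1 h2

theorem barTensorComul_counit (z : Bar A ⊗[R] Bar A) :
    TensorProduct.rid R _ (LinearMap.lTensor (Bar A ⊗[R] Bar A) (barTensorCounit A)
      (barTensorComul A z)) = z := by
  have key : ∀ y z : Bar A ⊗[R] Bar A, TensorProduct.rid R _ (LinearMap.lTensor
      (Bar A ⊗[R] Bar A) (barTensorCounit A)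
        (midSwap (braid (barGrading A) (barGrading A)) (y ⊗ₜ z))) =
      TensorProduct.rid R (Bar A) (LinearMap.lTensor (Bar A) (barCounit A) y) ⊗ₜ
      TensorProduct.rid R (Bar A) (LinearMap.lTensor (Bar A) (barCounit A) z) := by
    intro y z
    induction y using tensor_induction (barGrading A) (barGrading A) with
    | add x y h1 h2 => simp only [map_add, TensorProduct.add_tmul, h1, h2]
    | tmul i v hv j w hw =>
      induction z using tensor_induction (barGrading A) (barGrading A) with
      | add x y h1 h2 => simp only [map_add, TensorProduct.tmul_add, h1, h2]
      | tmul i' v' hv' j' w' hw' =>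
        rw [midSwap_tmul _ _ _ _ hw hv']
        by_cases hj : j = 0
        · subst hj
          simp only [zero_mul, ksign_zero, one_smul, barTensorCounit,
            LinearMap.lTensor_tmul, LinearMap.comp_apply, TensorProduct.map_tmul,
            LinearEquiv.coe_coe, TensorProduct.lid_tmul, TensorProduct.rid_tmul, smul_eq_mul,
            TensorProduct.smul_tmul_smul]
        · simp [barTensorCounit, barCounit_of_ne A hj hw]
  induction z with
  | zero => simp
  | add x y h1 h2 => simp only [map_add, h1, h2]
  | tmul x y =>
    rw [barTensorComul, LinearMap.comp_apply, TensorProduct.map_tmul, key, deconc_counit,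
      deconc_counit]

end BarCoalgebra

section Reduced

variable {R V : Type*} [CommRing R] [AddCommGroup V] [Module R V] {A : DGAlgebra R V}

/-- A word of non-zero letters has degree at least its length, because `A¹ = 0`. -/
theorem word_eq_zero_or (hA : A.IsOneReduced) (l : List (Σ i : {i : ℤ // 0 < i}, A.gr i)) :
    word A (l.map fun p => Submodule.inclusion (A.gr_le_pos p.1.2) p.2) = 0 ∨
      (l.length : ℤ) ≤ (l.map fun p => p.1.1 - 1).sum := by
  induction l with
  | nil => simp
  | cons p l ih =>
    obtain ⟨⟨i, hi⟩, a, ha⟩ := p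
    rw [List.map_cons, word_cons]
    rcases ih with ih | ih
    · left; rw [ih, mul_zero]
    · by_cases h1 : i = 1
      · subst h1
        left
        have ha' : a = 0 := by rwa [hA.deg_one, Submodule.mem_bot] at ha
        subst ha'
        have : Submodule.inclusion (A.gr_le_pos hi) ⟨0, ha⟩ = 0 := rfl
        rw [this, map_zero, zero_mul]
      · right
        simp only [List.length_cons, List.map_cons, List.sum_cons]
        push_cast
        omega

theorem barGr_neg (hA : A.IsOneReduced) {n : ℤ} (hn : n < 0) : barGr A n = ⊥ := by
  refine Submodule.span_eq_bot.2 ?_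
  rintro _ ⟨l, hl, rfl⟩
  rcases word_eq_zero_or hA l with h | h
  · exact h
  · omega

theorem barGr_zero (hA : A.IsOneReduced) : barGr A 0 ≤ Submodule.span R {1} := by
  refine Submodule.span_le.2 ?_
  rintro _ ⟨l, hl, rfl⟩
  rcases word_eq_zero_or hA l with h | h
  · rw [h]; exact zero_mem _
  · have : l = [] := List.length_eq_zero_iff.1 (by omega)
    subst this
    exact Submodule.subset_span rfl

variable (H : HomotopyGAlgebra A)

/-- The comultiplicative extension `μ_E` is a finite sum: `BA ⊗ BA` is non-negatively graded because
`A` is 1-reduced, and its part of degree `0` is spanned by `1 ⊗ 1`. -/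
theorem HomotopyGAlgebra.isReducedCochain :
    IsReducedCochain (tensorGrading (barGrading A) (barGrading A)) (barTensorComul A) H.E where
  neg i hi := by
    refine Submodule.span_eq_bot.2 ?_
    rintro _ ⟨j, k, v, hv, w, hw, hjk, rfl⟩
    rcases lt_or_ge j 0 with hj | hj
    · have : v = 0 := by
        have hv' : v ∈ barGr A j := hv
        rwa [barGr_neg H.reduced hj, Submodule.mem_bot] at hv'
      rw [this, TensorProduct.zero_tmul]
    · have : w = 0 := by
        have hw' : w ∈ barGr A k := hw
        rwa [barGr_neg H.reduced (by omega), Submodule.mem_bot] at hw'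
      rw [this, TensorProduct.tmul_zero]
  comul_mem n c hc := barTensorComul_mem A hc
  map_zero c hc := by
    have hE : H.E ((1 : Bar A) ⊗ₜ (1 : Bar A)) = 0 := by
      simpa [word] using H.E_eq_zero [] [] (by simp) (by simp)
    refine tensorGr_induction (p := fun c => H.E c = 0) ?_ ?_ hc
    · intro i v hv j w hw hij
      have hv' : v ∈ barGr A i := hv
      have hw' : w ∈ barGr A j := hw
      rcases lt_trichotomy i 0 with hi | rfl | hi
      · rw [barGr_neg H.reduced hi, Submodule.mem_bot] at hv'
        simp [hv']
      · obtain rfl : j = 0 := by omega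
        obtain ⟨r, rfl⟩ := Submodule.mem_span_singleton.1 (barGr_zero H.reduced hv')
        obtain ⟨s, rfl⟩ := Submodule.mem_span_singleton.1 (barGr_zero H.reduced hw')
        rw [TensorProduct.smul_tmul_smul, map_smul, hE, smul_zero]
      · rw [barGr_neg H.reduced (by omega), Submodule.mem_bot] at hw'
        simp [hw']
    · intro x y h1 h2
      rw [map_add, h1, h2, add_zero]

end Reduced

/-! ### The operations of a homotopy G-algebra -/

section Operations

variable {R V : Type*} [CommRing R] [AddCommGroup V] [Module R V] {A : DGAlgebra R V}
  (H : HomotopyGAlgebra A)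

theorem gr_zero_cases (hA : A.IsOneReduced) {a : V} (ha : a ∈ A.gr 0) : ∃ r : R, a = r • A.one := by
  rw [hA.zero] at ha
  obtain ⟨r, rfl⟩ := Submodule.mem_span_singleton.1 ha
  exact ⟨r, rfl⟩

theorem gr_neg_eq_zero (hA : A.IsOneReduced) {i : ℤ} (hi : i < 0) {a : V} (ha : a ∈ A.gr i) :
    a = 0 := by
  rwa [hA.neg i hi, Submodule.mem_bot] at ha

/-- `x ↦ E(x ⊗ w)`. -/
def HomotopyGAlgebra.evalAt (w : Bar A) : Bar A →ₗ[R] V := (TensorProduct.curry H.E).flip w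

@[simp] theorem HomotopyGAlgebra.evalAt_apply (w x : Bar A) : H.evalAt w x = H.E (x ⊗ₜ w) := rfl

theorem HomotopyGAlgebra.E_one (x : Bar A) : H.E (x ⊗ₜ 1) = barHead A x := by
  suffices h : H.evalAt 1 = A.pos.subtype ∘ₗ barHead A from LinearMap.congr_fun h x
  refine bar_hom_ext A fun l => ?_
  rw [H.evalAt_apply, LinearMap.comp_apply]
  match l with
  | [] =>
    have h := H.E_eq_zero [] [] (by simp) (by simp)
    simp only [word, List.map_nil, List.prod_nil] at h ⊢
    rw [h, barHead_one, map_zero]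
  | [a] =>
    have h := H.E_one_zero a
    rw [word_cons, barHead_cons]
    simpa [word] using h
  | a :: b :: l =>
    have h := H.E_eq_zero (a :: b :: l) [] (by simp) (by simp)
    rw [word_cons, word_cons, barHead_cons, barCounit_cons, zero_smul, map_zero]
    simpa [word] using h

/-- Since `E_{p,q}` vanishes for `q ≥ 2` and `E_{p,0}` for `p ≠ 1`, the map `E` depends on its
second argument only through the parts of length `0` and `1`. -/
theorem HomotopyGAlgebra.E_split (x w : Bar A) :
    H.E (x ⊗ₜ w) = H.E (x ⊗ₜ letter A (barHead A w)) + barCounit A w • (barHead A x : V) := by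
  suffices h : TensorProduct.curry H.E = (TensorProduct.curry H.E).compl₂
      (letter A ∘ₗ barHead A) + (LinearMap.lsmul R V ∘ₗ barCounit A).flip.compl₁₂
      (A.pos.subtype ∘ₗ barHead A) LinearMap.id from
    LinearMap.congr_fun₂ h x w
  refine bar_hom_ext A fun l => bar_hom_ext A fun l' => ?_
  simp only [LinearMap.add_apply, TensorProduct.curry_apply, LinearMap.compl₂_apply,
    LinearMap.compl₁₂_apply, LinearMap.flip_apply, LinearMap.comp_apply, LinearMap.lsmul_apply,
    LinearMap.id_apply, Submodule.subtype_apply]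
  match l' with
  | [] => simp [word, H.E_one]
  | [a] => simp [word]
  | a :: b :: l' =>
    rw [H.E_eq_zero l (a :: b :: l') (by simp) (by simp)]
    simp [word_cons]

theorem HomotopyGAlgebra.E_pair (x : Bar A) (a b : A.pos) :
    H.E (x ⊗ₜ (letter A a * letter A b)) = 0 := by
  rw [H.E_split]
  simp

theorem HomotopyGAlgebra.op_apply (x : Bar A) (a : V) : H.op x a =
    H.E (x ⊗ₜ letter A (A.toPos a)) + barCounit A x • (a - A.toPos a) := rfl

theorem HomotopyGAlgebra.op_coe (x : Bar A) (a : A.pos) : H.op x a = H.E (x ⊗ₜ letter A a) := by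
  rw [H.op_apply, toPos_coe, sub_self, smul_zero, add_zero]

theorem HomotopyGAlgebra.op_one_right (x : Bar A) : H.op x A.one = barCounit A x • A.one := by
  rw [H.op_apply, toPos_of_nonpos A le_rfl A.one_mem]
  simp

theorem HomotopyGAlgebra.op_of_pos (x : Bar A) {i : ℤ} (hi : 0 < i) {a : V} (ha : a ∈ A.gr i) :
    H.op x a = H.E (x ⊗ₜ letter A (A.toPos a)) := by
  rw [← H.op_coe, coe_toPos_of_pos A hi ha]

theorem HomotopyGAlgebra.op_mem {n i : ℤ} {x : Bar A} {a : V} (hx : x ∈ barGr A n)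
    (ha : a ∈ A.gr i) : H.op x a ∈ A.gr (n + i) := by
  rcases lt_trichotomy i 0 with hi | rfl | hi
  · rw [gr_neg_eq_zero H.reduced hi ha, map_zero]; exact zero_mem _
  · obtain ⟨r, rfl⟩ := gr_zero_cases H.reduced ha
    rw [map_smul, H.op_one_right]
    by_cases hn : n = 0
    · subst hn
      exact Submodule.smul_mem _ _ (Submodule.smul_mem _ _ A.one_mem)
    · rw [barCounit_of_ne A hn hx, zero_smul, smul_zero]; exact zero_mem _
  · rw [H.op_of_pos x hi ha]
    have h := H.E_mem (n + (i - 1)) _ (tmul_mem_tensorGr (G := barGrading A) (H := barGrading A)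
      hx (letter_toPos_mem A ha))
    rwa [show n + (i - 1) + 1 = n + i by ring] at h

theorem HomotopyGAlgebra.op_one_left (a : V) : H.op 1 a = a := by
  rw [H.op_apply, H.E_zero_one]
  simp

/-- `E(x ⊗ [a])` lies in `A_{>0}`, since `BA` is non-negatively graded. -/
theorem HomotopyGAlgebra.coe_toPos_E (x : Bar A) (a : A.pos) :
    (A.toPos (H.E (x ⊗ₜ letter A a)) : V) = H.E (x ⊗ₜ letter A a) := by
  induction a using pos_induction with
  | zero => simp
  | add a b h1 h2 => simp only [map_add, TensorProduct.tmul_add, Submodule.coe_add, h1, h2]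
  | mem i hi a =>
    rw [← H.op_coe]
    induction x using (barGrading A).induction with
    | add x y h1 h2 => simp only [map_add, LinearMap.add_apply, Submodule.coe_add, h1, h2]
    | mem n x hx =>
      have hx' : x ∈ barGr A n := hx
      rcases lt_or_ge n 0 with hn | hn
      · rw [barGr_neg H.reduced hn, Submodule.mem_bot] at hx'
        simp [hx']
      · exact coe_toPos_of_pos A (by omega) (H.op_mem (a := a) hx' a.2)

theorem HomotopyGAlgebra.barCounit_barMul (x y : Bar A) :
    barCounit A (H.barMul (x ⊗ₜ y)) = barCounit A x * barCounit A y := by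
  rw [HomotopyGAlgebra.barMul, barCounit_comulExt H.isReducedCochain]
  simp [barTensorCounit]

theorem HomotopyGAlgebra.barHead_barMul (z : Bar A ⊗[R] Bar A) :
    barHead A (H.barMul z) = A.toPos (H.E z) := by
  rw [HomotopyGAlgebra.barMul, barHead_comulExt H.isReducedCochain (barTensorComul_counit A)]

/-- Associativity of `μ_E`, projected to `A`: the operations are an action of the algebra `BA`. -/
theorem HomotopyGAlgebra.op_barMul (x y : Bar A) (a : V) :
    H.op (H.barMul (x ⊗ₜ y)) a = H.op x (H.op y a) := by
  have hp : ∀ b : A.pos, H.op (H.barMul (x ⊗ₜ y)) b = H.op x (H.op y b) := by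
    intro b
    have h := congrArg (fun z => (barHead A z : V)) (H.assoc x y (letter A b))
    change (barHead A (H.barMul (H.barMul (x ⊗ₜ y) ⊗ₜ letter A b)) : V) =
      barHead A (H.barMul (x ⊗ₜ H.barMul (y ⊗ₜ letter A b))) at h
    rw [H.barHead_barMul, H.barHead_barMul, H.coe_toPos_E, H.E_split x, H.barHead_barMul,
      H.barCounit_barMul, barCounit_letter, mul_zero, zero_smul, add_zero, H.coe_toPos_E] at h
    rw [H.op_coe, h, H.op_coe y, ← H.coe_toPos_E y, H.op_coe x, toPos_coe]
  induction a using A.toGrading.induction with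
  | add a b h1 h2 => simp only [map_add, h1, h2]
  | mem i a ha =>
    rcases lt_trichotomy i 0 with hi | rfl | hi
    · rw [gr_neg_eq_zero H.reduced hi ha]; simp
    · obtain ⟨r, rfl⟩ := gr_zero_cases H.reduced ha
      simp only [map_smul, H.op_one_right, H.barCounit_barMul, mul_smul]
      rw [smul_comm (barCounit A y)]
    · rw [← coe_toPos_of_pos A hi ha, hp]

/-- The part of the cup product `E ⌣ E` on `x ⊗ v` that comes from a summand `w ⊗ w'` of `Δ v`, with
`Δ x` replaced by an arbitrary tensor `y`. -/
theorem HomotopyGAlgebra.cup_midSwap {n : ℤ} {w w' : Bar A} (hw : w ∈ barGr A n)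
    (y : Bar A ⊗[R] Bar A) :
    TensorProduct.lift A.mul (TensorProduct.map
        (H.E ∘ₗ TensorProduct.map (barGrading A).sgn (barGrading A).sgn) H.E
        (midSwap (braid (barGrading A) (barGrading A)) (y ⊗ₜ (w ⊗ₜ w')))) =
      ksign R n • TensorProduct.lift A.mul (TensorProduct.map (H.evalAt w ∘ₗ (barGrading A).sgn)
        (H.evalAt w' ∘ₗ (barGrading A).signPow n) y) := by
  induction y using tensor_induction (barGrading A) (barGrading A) with
  | add x y h1 h2 => simp only [map_add, TensorProduct.add_tmul, smul_add, h1, h2]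
  | tmul i u hu j v hv =>
    rw [midSwap_tmul (barGrading A) (barGrading A) u w' hv hw]
    have hs : (barGrading A).sgn w = ksign R n • w := (barGrading A).sgn_of_mem' hw
    simp only [map_smul, TensorProduct.map_tmul, LinearMap.comp_apply, TensorProduct.lift.tmul,
      H.evalAt_apply, (barGrading A).signPow_of_mem n hv, hs, TensorProduct.tmul_smul,
      ← TensorProduct.smul_tmul']
    rw [smul_comm, mul_comm n j]

theorem barD_letter (a : A.pos) : barD A (letter A a) = -letter A (A.toPos (A.d a)) := by
  have h := barD_cons A a 1
  rw [merge_one, barD_one] at h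
  simpa using h

theorem barCounit_barD (x : Bar A) : barCounit A (barD A x) = 0 := by
  suffices h : barCounit A ∘ₗ barD A = 0 from LinearMap.congr_fun h x
  refine bar_hom_ext A fun l => ?_
  match l with
  | [] => simp [word, barD_one]
  | [a] => simp [word, barD_letter]
  | a :: b :: l => simp [word_cons, barD_cons, merge_cons]

theorem HomotopyGAlgebra.op_flip_of_pos {i : ℤ} (hi : 0 < i) {a : V} (ha : a ∈ A.gr i) :
    H.op.flip a = H.evalAt (letter A (A.toPos a)) :=
  LinearMap.ext fun x => H.op_of_pos x hi ha

/-- The twisting cochain condition for `E` on `[a₁|…|aₖ] ⊗ [a]`. -/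
theorem HomotopyGAlgebra.d_op {i : ℤ} {a : V} (ha : a ∈ A.gr i) (x : Bar A) :
    A.d (H.op x a) = -H.op (barD A x) a + H.op ((barGrading A).sgn x) (A.d a) -
      TensorProduct.lift A.mul (TensorProduct.map (H.evalAt 1 ∘ₗ (barGrading A).sgn)
        (H.op.flip a) (deconc A x)) +
      ksign R i • TensorProduct.lift A.mul (TensorProduct.map (H.op.flip a ∘ₗ (barGrading A).sgn)
        (H.evalAt 1 ∘ₗ (barGrading A).signPow (i - 1)) (deconc A x)) := by
  rcases lt_trichotomy i 0 with hi | rfl | hi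
  · rw [gr_neg_eq_zero H.reduced hi ha]; simp
  · obtain ⟨r, rfl⟩ := gr_zero_cases H.reduced ha
    -- in degree `0` the left side vanishes, and the two cup products cancel by counitality
    have k1 : ∀ y : Bar A ⊗[R] Bar A, TensorProduct.lift A.mul (TensorProduct.map
        (H.evalAt 1 ∘ₗ (barGrading A).sgn) (H.op.flip A.one) y) = H.evalAt 1 ((barGrading A).sgn
          (TensorProduct.rid R (Bar A) (LinearMap.lTensor (Bar A) (barCounit A) y))) := by
      intro y
      induction y with
      | zero => simp
      | add y z h1 h2 => simp only [map_add, h1, h2]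
      | tmul u v => simp [H.op_one_right, A.mul_one]
    have k2 : ∀ y : Bar A ⊗[R] Bar A, TensorProduct.lift A.mul (TensorProduct.map
        (H.op.flip A.one ∘ₗ (barGrading A).sgn) (H.evalAt 1 ∘ₗ (barGrading A).sgn) y) =
          H.evalAt 1 ((barGrading A).sgn
            (TensorProduct.lid R (Bar A) (LinearMap.rTensor (Bar A) (barCounit A) y))) := by
      intro y
      induction y with
      | zero => simp
      | add y z h1 h2 => simp only [map_add, h1, h2]
      | tmul u v => simp [H.op_one_right, A.one_mul, Grading.sgn, barCounit_signPow]
    have hs : (barGrading A).signPow (0 - 1) = (barGrading A).sgn :=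
      (barGrading A).signPow_congr (by decide)
    simp only [map_smul, LinearMap.smul_comp, TensorProduct.map_smul_left,
      TensorProduct.map_smul_right, LinearMap.smul_apply, hs, k1, k2, deconc_counit, counit_deconc,
      A.d_one, H.op_one_right, barCounit_barD, ksign_zero]
    simp
  · have h := H.brown (x ⊗ₜ letter A (A.toPos a))
    have hl := letter_toPos_mem A ha
    have ht : tensorD (barGrading A) (barD A) (barD A) (x ⊗ₜ letter A (A.toPos a)) =
        barD A x ⊗ₜ letter A (A.toPos a) -
          (barGrading A).sgn x ⊗ₜ letter A (A.toPos (A.d a)) := by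
      simp [tensorD, barD_letter, coe_toPos_of_pos A hi ha, TensorProduct.tmul_neg,
        sub_eq_add_neg]
    rw [ht, barTensorComul, LinearMap.comp_apply, TensorProduct.map_tmul, deconc_letter,
      TensorProduct.tmul_add, map_add, map_add, map_add, H.cup_midSwap SetLike.GradedOne.one_mem,
      H.cup_midSwap hl, map_sub, ← H.op_of_pos _ hi ha, ← H.op_of_pos _ hi ha,
      ← H.op_of_pos _ (by omega) (A.d_mem i a ha), ← H.op_flip_of_pos hi ha, ksign_zero, one_smul,
      (barGrading A).signPow_zero, LinearMap.comp_id] at h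
    rw [eq_sub_of_add_eq h, ← sub_add_cancel i 1, ksign_add, ksign_one]
    simp only [add_sub_cancel_right, mul_neg, mul_one, neg_smul]
    abel

/-- The twisting cochain condition for `E` on `[a₁|…|aₖ] ⊗ [a|b]`: the Cartan formula. -/
theorem HomotopyGAlgebra.op_mul {i : ℤ} {a : V} (ha : a ∈ A.gr i) (b : V) (x : Bar A) :
    H.op x (A.mul a b) = TensorProduct.lift A.mul (TensorProduct.map (H.op.flip a)
        (H.op.flip b ∘ₗ (barGrading A).signPow i) (deconc A x)) := by
  rcases lt_trichotomy i 0 with hi | rfl | hi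
  · rw [gr_neg_eq_zero H.reduced hi ha]; simp
  · obtain ⟨r, rfl⟩ := gr_zero_cases H.reduced ha
    -- scalars `a` act through the counit
    have key : ∀ y : Bar A ⊗[R] Bar A, TensorProduct.lift A.mul (TensorProduct.map
        (H.op.flip A.one) (H.op.flip b) y) =
        H.op (TensorProduct.lid R (Bar A) (LinearMap.rTensor (Bar A) (barCounit A) y)) b := by
      intro y
      induction y with
      | zero => simp
      | add y z h1 h2 => simp only [map_add, LinearMap.add_apply, h1, h2]
      | tmul u v => simp [H.op_one_right, A.one_mul]
    rw [(barGrading A).signPow_zero, LinearMap.comp_id, map_smul, map_smul,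
      TensorProduct.map_smul_left, LinearMap.smul_apply, LinearMap.smul_apply, map_smul, map_smul,
      key, counit_deconc, A.one_mul]
  induction b using A.toGrading.induction with
  | add b b' h1 h2 =>
    rw [map_add, map_add, h1, h2, map_add, LinearMap.add_comp, TensorProduct.map_add_right,
      LinearMap.add_apply, map_add]
  | mem j b hb =>
    rcases lt_trichotomy j 0 with hj | rfl | hj
    · rw [gr_neg_eq_zero H.reduced hj hb]; simp
    · obtain ⟨r, rfl⟩ := gr_zero_cases H.reduced hb
      have key : ∀ y : Bar A ⊗[R] Bar A, TensorProduct.lift A.mul (TensorProduct.map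
          (H.op.flip a) (H.op.flip A.one ∘ₗ (barGrading A).signPow i) y) =
          H.op (TensorProduct.rid R (Bar A) (LinearMap.lTensor (Bar A) (barCounit A) y)) a := by
        intro y
        induction y with
        | zero => simp
        | add y z h1 h2 => simp only [map_add, LinearMap.add_apply, h1, h2]
        | tmul u v => simp [H.op_one_right, A.mul_one, barCounit_signPow]
      rw [map_smul, map_smul, map_smul, LinearMap.smul_comp, TensorProduct.map_smul_right,
        LinearMap.smul_apply, map_smul, key, deconc_counit, A.mul_one]
    · -- the sign of `x` absorbs the sign `(-1)^{|x|}` with which `d` passes `x`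
      have h := H.brown ((barGrading A).sgn x ⊗ₜ (letter A (A.toPos a) * letter A (A.toPos b)))
      have hl := letter_toPos_mem A ha
      have hab : letter A (A.toPos a) * letter A (A.toPos b) ∈ barGr A (i - 1 + (j - 1)) :=
        SetLike.GradedMul.mul_mem hl (letter_toPos_mem A hb)
      have hz : H.evalAt (letter A (A.toPos a) * letter A (A.toPos b)) = 0 :=
        LinearMap.ext fun x => H.E_pair x _ _
      have ht : H.E (tensorD (barGrading A) (barD A) (barD A) ((barGrading A).sgn x ⊗ₜ
          (letter A (A.toPos a) * letter A (A.toPos b)))) =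
          ksign R i • H.op x (A.mul a b) := by
        have hm : merge A (letter A (A.toPos b)) (barSgn A (A.toPos a)) =
            -(ksign R i • letter A (A.toPos (A.mul a b))) := by
          have h := merge_cons A (barSgn A (A.toPos a)) (A.toPos b) 1
          rw [mul_one, mul_one] at h
          rw [h]
          simp [barSgn, coe_toPos_of_pos A hi ha, coe_toPos_of_pos A hj hb,
            A.toGrading.sgn_of_mem' ha]
        rw [H.op_of_pos x (by omega) (A.mul_mem i j a ha b hb)]
        simp [tensorD, barD_cons, hm, H.E_pair, barD_letter, TensorProduct.tmul_add,
          TensorProduct.tmul_neg, mul_neg, Grading.sgn_sgn,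
          TensorProduct.tmul_smul]
      rw [ht, H.E_pair, map_zero, zero_add, barTensorComul, LinearMap.comp_apply,
        TensorProduct.map_tmul, deconc_cons, deconc_letter, map_add, LinearMap.rTensor_tmul,
        LinearMap.rTensor_tmul, LinearMap.mulLeft_apply, LinearMap.mulLeft_apply, mul_one,
        TensorProduct.tmul_add, TensorProduct.tmul_add, map_add, map_add, map_add, map_add,
        map_add, map_add, H.cup_midSwap SetLike.GradedOne.one_mem,
        H.cup_midSwap hl, H.cup_midSwap hab, hz, LinearMap.zero_comp, LinearMap.zero_comp,
        TensorProduct.map_zero_left, TensorProduct.map_zero_right] at h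
      have key : ∀ y : Bar A ⊗[R] Bar A, ksign R i • -(ksign R (i - 1) •
          TensorProduct.lift A.mul (TensorProduct.map
            (H.op.flip a ∘ₗ (barGrading A).sgn) (H.op.flip b ∘ₗ (barGrading A).signPow (i - 1))
            (TensorProduct.map (barGrading A).sgn (barGrading A).sgn y))) =
          TensorProduct.lift A.mul (TensorProduct.map
            (H.op.flip a) (H.op.flip b ∘ₗ (barGrading A).signPow i) y) := by
        intro y
        induction y using tensor_induction (barGrading A) (barGrading A) with
        | add x y h1 h2 => simp only [map_add, neg_add, smul_add, h1, h2]
        | tmul k u hu l v hv =>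
          simp only [TensorProduct.map_tmul, LinearMap.comp_apply, Grading.sgn_sgn,
            (barGrading A).sgn_of_mem' hv, map_smul, (barGrading A).signPow_of_mem _ hv,
            TensorProduct.lift.tmul, ← neg_smul, smul_smul, neg_ksign, ← ksign_add]
          congr 1
          refine ksign_congr ?_
          simp only [parity_simps]
          tauto
      rw [← key, ← deconc_sgn, ← one_smul R (H.op x (A.mul a b)), ← ksign_mul_self i, mul_smul]
      rw [← H.op_flip_of_pos hi ha, ← H.op_flip_of_pos hj hb] at h
      congr 1
      simpa using h

end Operations

/-! ### The action of `C` on `A` -/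

section Action

variable {R V U : Type*} [CommRing R] [AddCommGroup V] [Module R V] [AddCommGroup U] [Module R U]

/-- A degree-preserving action `T : C ⊗ A → A` of the dg Hopf algebra `C` on the dga `A`, together
with a twisting cochain `φ : C → A` that measures its failure to be a chain map: `A` is a module
over the algebra `C`, the product of `A` satisfies the Cartan formula
`T c (a b) = ∑ ± T c₁ a · T c₂ b`, and `d (T c a) = T (d c) a ± T c (d a)` holds up to
the graded commutator `∑ ± T c₁ a · φ c₂ - φ c₁ · T c₂ a`. -/
structure IsTwistedAction (A : DGAlgebra R V) (C : DGHopfAlgebra R U) (φ : U →ₗ[R] V)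
    (T : U →ₗ[R] V →ₗ[R] V) : Prop where
  cochain_mem : ∀ n, ∀ c ∈ C.gr n, φ c ∈ A.gr (n + 1)
  cochain_one : φ C.one = 0
  brown : BrownCondition C.sgn C.d C.comul A φ
  cochain_mul : ∀ b c, φ (C.mul b c) = C.counit c • φ b + T (C.sgn b) (φ c)
  act_mem : ∀ n i, ∀ c ∈ C.gr n, ∀ a ∈ A.gr i, T c a ∈ A.gr (n + i)
  one_act : ∀ a, T C.one a = a
  mul_act : ∀ b c a, T (C.mul b c) a = T b (T c a)
  act_one : ∀ c, T c A.one = C.counit c • A.one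
  act_mul : ∀ i, ∀ a ∈ A.gr i, ∀ b c, T c (A.mul a b) = TensorProduct.lift A.mul
    (TensorProduct.map (T.flip a) (T.flip b ∘ₗ C.signPow i) (C.comul c))
  d_act : ∀ i, ∀ a ∈ A.gr i, ∀ c, A.d (T c a) = T (C.d c) a + T (C.sgn c) (A.d a) -
    TensorProduct.lift A.mul (TensorProduct.map φ (T.flip a) (C.comul c)) +
    ksign R i • TensorProduct.lift A.mul
      (TensorProduct.map (T.flip a ∘ₗ C.sgn) (φ ∘ₗ C.signPow i) (C.comul c))

variable {A : DGAlgebra R V} {C : DGHopfAlgebra R U} {φ : U →ₗ[R] V}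

theorem DGHopfAlgebra.counit_d (C : DGHopfAlgebra R U) (c : U) : C.counit (C.d c) = 0 := by
  induction c using C.toGrading.induction with
  | add x y h1 h2 => rw [map_add, map_add, h1, h2, add_zero]
  | mem n c hc =>
    rcases eq_or_ne (n + 1) 0 with hn | hn
    · rw [C.connected.neg n (by omega), Submodule.mem_bot] at hc
      simp [hc]
    · exact C.counit_of_ne _ hn _ (C.d_mem n c hc)

theorem DGHopfAlgebra.counit_signPow (C : DGHopfAlgebra R U) (i : ℤ) (c : U) :
    C.counit (C.signPow i c) = C.counit c := by
  induction c using C.toGrading.induction with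
  | mem n x hx =>
    rw [C.signPow_of_mem i hx, map_smul]
    by_cases hn : n = 0
    · simp [hn]
    · rw [C.counit_of_ne n hn x hx, smul_zero]
  | add x y h1 h2 => simp only [map_add, h1, h2]

theorem DGHopfAlgebra.comul_sgn (C : DGHopfAlgebra R U) (c : U) :
    C.comul (C.sgn c) = TensorProduct.map C.sgn C.sgn (C.comul c) := by
  rw [map_sgn_of_degree C.toGrading (tensorGrading C.toGrading C.toGrading) C.comul 0
    (fun i x hx => by rw [add_zero]; exact C.comul_mem i x hx), tensorGrading_sgn, ksign_zero,
    one_smul]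

theorem isReducedCochain_of_degree (hA : A.IsOneReduced)
    (hφ : ∀ n, ∀ c ∈ C.gr n, φ c ∈ A.gr (n + 1)) :
    IsReducedCochain C.toGrading C.comul φ where
  neg := C.connected.neg
  comul_mem := C.comul_mem
  map_zero c hc := by
    have h := hφ 0 c hc
    rwa [zero_add, hA.deg_one, Submodule.mem_bot] at h

/-- The action `c ⊗ a ↦ (-1)^{|c|} ∑ E_{k,1}(φ c⁽¹⁾, …, φ c⁽ᵏ⁾; a)`. -/
def cochainAct (H : HomotopyGAlgebra A) (C : DGHopfAlgebra R U) (φ : U →ₗ[R] V) :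
    U →ₗ[R] V →ₗ[R] V :=
  H.op ∘ₗ comulExt C.comul C.counit A φ ∘ₗ C.sgn

theorem cochainAct_apply (H : HomotopyGAlgebra A) (c : U) (a : V) :
    cochainAct H C φ c a = H.op (comulExt C.comul C.counit A φ (C.sgn c)) a := rfl

theorem IsMultiplicativeTwistingCochain.isTwistedAction {H : HomotopyGAlgebra A}
    (hφ : IsMultiplicativeTwistingCochain H C φ) :
    IsTwistedAction A C φ (cochainAct H C φ) := by
  have hr := isReducedCochain_of_degree H.reduced hφ.degree
  have hmem : ∀ n, ∀ c ∈ C.gr n, comulExt C.comul C.counit A φ c ∈ (barGrading A).gr n :=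
    fun n c hc => comulExt_mem hr hφ.degree C.counit_of_ne hc
  have hhead : ∀ c, (barHead A (comulExt C.comul C.counit A φ c) : V) = φ c := fun c => by
    rw [barHead_comulExt hr C.comul_counit]
    induction c using C.toGrading.induction with
    | add x y h1 h2 => simp only [map_add, Submodule.coe_add, h1, h2]
    | mem n c hc =>
      rcases lt_trichotomy n 0 with hn | rfl | hn
      · rw [hr.neg n hn, Submodule.mem_bot] at hc
        simp [hc]
      · simp [hr.map_zero c hc]
      · exact coe_toPos_of_pos A (by omega) (hφ.degree n c hc)
  have hcounit := barCounit_comulExt (A := A) (ε := C.counit) hr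
  have hsgn : ∀ n c, comulExt C.comul C.counit A φ (C.signPow n c) =
      (barGrading A).signPow n (comulExt C.comul C.counit A φ c) := fun n c =>
    map_signPow_of_degree_zero C.toGrading (barGrading A) _ hmem n c
  have hdeconc := deconc_comulExt (A := A) hr C.coassoc C.counit_comul
  have hd := barD_comulExt hr hφ.degree C.coassoc C.comul_d C.counit_d hφ.brown
  refine ⟨hφ.degree, hr.map_zero _ C.one_mem, hφ.brown, ?_, ?_, ?_, ?_, ?_, ?_, ?_⟩
  · intro b c
    have h := hφ.map_mul b c
    apply_fun fun x => (barHead A x : V) at h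
    rw [hhead, H.barHead_barMul, H.E_split, hcounit, map_add, Submodule.coe_add,
      H.coe_toPos_E, map_smul, toPos_coe, Submodule.coe_smul, hhead, ← H.op_coe, hhead] at h
    rw [h, cochainAct_apply, C.sgn_sgn, add_comm]
  · intro n i c hc a ha
    exact H.op_mem (hmem n _ (C.sgn_mem hc)) ha
  · intro a
    rw [cochainAct_apply, C.sgn_one, hφ.map_one, H.op_one_left]
  · intro b c a
    simp only [cochainAct_apply, C.sgn_mul, hφ.map_mul, H.op_barMul]
  · intro c
    rw [cochainAct_apply, H.op_one_right, hcounit, Grading.sgn, C.counit_signPow]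
  · intro i a ha b c
    rw [cochainAct_apply, H.op_mul ha, hdeconc, C.comul_sgn]
    induction C.comul c with
    | zero => simp
    | add x y h1 h2 => simp only [map_add, h1, h2]
    | tmul u v =>
      have h : C.sgn (C.signPow i v) = C.signPow i (C.sgn v) :=
        map_signPow_of_degree_zero C.toGrading C.toGrading C.sgn (fun i v hv => C.sgn_mem hv) i v
      simp [cochainAct_apply, h, hsgn]
  · intro i a ha c
    have hs1 : ∀ c, (barGrading A).sgn (comulExt C.comul C.counit A φ c) =
        comulExt C.comul C.counit A φ (C.sgn c) := fun c => (hsgn 1 c).symm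
    have hs2 : ∀ v, C.signPow (i - 1) (C.sgn v) = C.signPow i v := fun v => by
      induction v using C.toGrading.induction with
      | add x y h1 h2 => simp only [map_add, h1, h2]
      | mem n v hv =>
        rw [C.sgn_of_mem' hv, map_smul, C.signPow_of_mem _ hv, C.signPow_of_mem _ hv, smul_smul,
          ← ksign_add, ksign_congr]
        simp only [parity_simps]
        tauto
    rw [cochainAct_apply, H.d_op ha, hd, C.d_sgn, hs1, hdeconc, C.comul_sgn]
    congr 1
    · congr 1
      · simp [cochainAct_apply]
      · induction C.comul c with
        | zero => simp
        | add x y h1 h2 => simp only [map_add, h1, h2]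
        | tmul u v => simp [cochainAct_apply, hs1, H.E_one, hhead, Grading.sgn_sgn]
    · congr 1
      induction C.comul c with
      | zero => simp
      | add x y h1 h2 => simp only [map_add, h1, h2]
      | tmul u v =>
        simp [cochainAct_apply, hs1, H.E_one, hhead, ← hsgn, hs2, Grading.sgn_sgn]

end Action

/-! ### The twisted product of `A ⊗ M` -/

section Product

variable {R V U W : Type*} [CommRing R] [AddCommGroup V] [Module R V] [AddCommGroup U] [Module R U]
  [AddCommGroup W] [Module R W] {A : DGAlgebra R V} {C : DGHopfAlgebra R U} {M : DGAlgebra R W}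

/-- Left multiplication by elements of `A` on `A ⊗ M`. -/
def leftAct (A : DGAlgebra R V) (W : Type*) [AddCommGroup W] [Module R W] :
    V →ₗ[R] V ⊗[R] W →ₗ[R] V ⊗[R] W := LinearMap.rTensorHom W ∘ₗ A.mul

/-- Right multiplication by elements of `M` on `A ⊗ M`. -/
def rightAct (V : Type*) [AddCommGroup V] [Module R V] (M : DGAlgebra R W) :
    W →ₗ[R] V ⊗[R] W →ₗ[R] V ⊗[R] W := LinearMap.lTensorHom V ∘ₗ M.mul.flip

@[simp] theorem leftAct_tmul (a b : V) (m : W) :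
    leftAct A W a (b ⊗ₜ[R] m) = A.mul a b ⊗ₜ m := rfl

@[simp] theorem rightAct_tmul (a : V) (m n : W) :
    rightAct V M n (a ⊗ₜ[R] m) = a ⊗ₜ M.mul m n := rfl

theorem leftAct_leftAct (a b : V) (z : V ⊗[R] W) :
    leftAct A W a (leftAct A W b z) = leftAct A W (A.mul a b) z := by
  induction z with
  | zero => simp
  | add x y h1 h2 => simp only [map_add, h1, h2]
  | tmul v w => simp [A.mul_assoc]

theorem rightAct_rightAct (m n : W) (z : V ⊗[R] W) :
    rightAct V M m (rightAct V M n z) = rightAct V M (M.mul n m) z := by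
  induction z with
  | zero => simp
  | add x y h1 h2 => simp only [map_add, h1, h2]
  | tmul v w => simp [M.mul_assoc]

theorem leftAct_rightAct (a : V) (n : W) (z : V ⊗[R] W) :
    leftAct A W a (rightAct V M n z) = rightAct V M n (leftAct A W a z) := by
  induction z with
  | zero => simp
  | add x y h1 h2 => simp only [map_add, h1, h2]
  | tmul v w => simp

theorem leftAct_one (z : V ⊗[R] W) : leftAct A W A.one z = z := by
  induction z with
  | zero => simp
  | add x y h1 h2 => simp only [map_add, h1, h2]
  | tmul v w => simp [A.one_mul]

theorem rightAct_one (z : V ⊗[R] W) : rightAct V M M.one z = z := by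
  induction z with
  | zero => simp
  | add x y h1 h2 => simp only [map_add, h1, h2]
  | tmul v w => simp [M.mul_one]

theorem leftAct_mem {i n : ℤ} {a : V} (ha : a ∈ A.gr i) {z : V ⊗[R] W}
    (hz : z ∈ tensorGr A.toGrading M.toGrading n) :
    leftAct A W a z ∈ tensorGr A.toGrading M.toGrading (i + n) := by
  refine tensorGr_induction (p := fun z => leftAct A W a z ∈ _) ?_ ?_ hz
  · rintro j v hv k w hw rfl
    rw [← add_assoc]
    exact tmul_mem_tensorGr (A.mul_mem i j a ha v hv) hw
  · intro x y hx hy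
    rw [map_add]
    exact add_mem hx hy

theorem rightAct_mem {i n : ℤ} {m : W} (hm : m ∈ M.gr i) {z : V ⊗[R] W}
    (hz : z ∈ tensorGr A.toGrading M.toGrading n) :
    rightAct V M m z ∈ tensorGr A.toGrading M.toGrading (n + i) := by
  refine tensorGr_induction (p := fun z => rightAct V M m z ∈ _) ?_ ?_ hz
  · rintro j v hv k w hw rfl
    rw [add_assoc]
    exact tmul_mem_tensorGr hv (M.mul_mem k i w hw m hm)
  · intro x y hx hy
    rw [map_add]
    exact add_mem hx hy

/-- `a` moved past the elements of `C ⊗ M`: `(c ⊗ m) ↦ (-1)^{|a||m|} T c a ⊗ m`. -/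
def actTensor (A : DGAlgebra R V) (M : DGAlgebra R W) (T : U →ₗ[R] V →ₗ[R] V) :
    V →ₗ[R] U ⊗[R] W →ₗ[R] V ⊗[R] W :=
  A.sum fun i => (TensorProduct.mapBilinear (RingHom.id R) U W V W).flip (M.signPow i) ∘ₗ
    T.flip ∘ₗ (A.gr i).subtype

theorem actTensor_of_mem (T : U →ₗ[R] V →ₗ[R] V) {i : ℤ} {a : V} (ha : a ∈ A.gr i) :
    actTensor A M T a = TensorProduct.map (T.flip a) (M.signPow i) := by
  rw [actTensor, A.sum_of_mem _ ha]
  rfl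

/-- The twisted product
`(a₁ ⊗ m₁) ⊗ (a₂ ⊗ m₂) ↦ ∑ (-1)^{|a₂||m₁'|} a₁ T c a₂ ⊗ m₁' m₂` for `m₁ ↦ ∑ c ⊗ m₁'`. -/
def smashMul (A : DGAlgebra R V) (N : DGComodule C M) (T : U →ₗ[R] V →ₗ[R] V) :
    (V ⊗[R] W) ⊗[R] (V ⊗[R] W) →ₗ[R] V ⊗[R] W :=
  TensorProduct.map (TensorProduct.lift A.mul ∘ₗ LinearMap.lTensor V (TensorProduct.lift T) ∘ₗ
      (TensorProduct.assoc R V U V).toLinearMap) (TensorProduct.lift M.mul) ∘ₗ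
    midSwap (braid M.toGrading A.toGrading) ∘ₗ
    LinearMap.rTensor (V ⊗[R] W)
      ((TensorProduct.assoc R V U W).symm.toLinearMap ∘ₗ LinearMap.lTensor V N.coact)

variable {N : DGComodule C M} {T : U →ₗ[R] V →ₗ[R] V} {φ : U →ₗ[R] V}

theorem smashMul_tmul (a b : V) (m n : W) : smashMul A N T ((a ⊗ₜ m) ⊗ₜ (b ⊗ₜ n)) =
    leftAct A W a (rightAct V M n (actTensor A M T b (N.coact m))) := by
  have key : ∀ y : U ⊗[R] W, TensorProduct.map (TensorProduct.lift A.mul ∘ₗ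
      LinearMap.lTensor V (TensorProduct.lift T) ∘ₗ
      (TensorProduct.assoc R V U V).toLinearMap) (TensorProduct.lift M.mul)
      (midSwap (braid M.toGrading A.toGrading)
        ((TensorProduct.assoc R V U W).symm (a ⊗ₜ y) ⊗ₜ (b ⊗ₜ n))) =
      leftAct A W a (rightAct V M n (actTensor A M T b y)) := by
    intro y
    induction y using tensor_induction C.toGrading M.toGrading with
    | add x y h1 h2 => simp only [map_add, TensorProduct.tmul_add, TensorProduct.add_tmul, h1, h2]
    | tmul j c hc k w hw =>
      induction b using A.toGrading.induction with
      | add x y h1 h2 =>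
        simp only [map_add, TensorProduct.tmul_add, TensorProduct.add_tmul, LinearMap.add_apply,
          h1, h2]
      | mem i b hb =>
        rw [TensorProduct.assoc_symm_tmul, midSwap_tmul M.toGrading A.toGrading _ _ hw hb,
          actTensor_of_mem T hb]
        simp [M.signPow_of_mem i hw, mul_comm i k]
  rw [← key]
  simp [smashMul]

theorem smashMul_leftAct (a : V) (x y : V ⊗[R] W) :
    smashMul A N T (leftAct A W a x ⊗ₜ y) = leftAct A W a (smashMul A N T (x ⊗ₜ y)) := by
  induction x with
  | zero => simp
  | add x x' h1 h2 => simp only [map_add, TensorProduct.add_tmul, h1, h2]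
  | tmul b m =>
    induction y with
    | zero => simp
    | add y y' h1 h2 => simp only [map_add, TensorProduct.tmul_add, h1, h2]
    | tmul b' n => rw [leftAct_tmul, smashMul_tmul, smashMul_tmul, leftAct_leftAct]

theorem smashMul_rightAct (n : W) (x y : V ⊗[R] W) :
    smashMul A N T (x ⊗ₜ rightAct V M n y) = rightAct V M n (smashMul A N T (x ⊗ₜ y)) := by
  induction x with
  | zero => simp
  | add x x' h1 h2 => simp only [map_add, TensorProduct.add_tmul, h1, h2]
  | tmul b m =>
    induction y with
    | zero => simp
    | add y y' h1 h2 => simp only [map_add, TensorProduct.tmul_add, h1, h2]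
    | tmul b' n' =>
      rw [rightAct_tmul, smashMul_tmul, smashMul_tmul, ← leftAct_rightAct, rightAct_rightAct]

/-- Moving `a` past `m`. -/
theorem smashMul_one_tmul (m : W) (a : V) :
    smashMul A N T ((A.one ⊗ₜ m) ⊗ₜ (a ⊗ₜ M.one)) = actTensor A M T a (N.coact m) := by
  rw [smashMul_tmul, leftAct_one, rightAct_one]

theorem IsTwistedAction.actTensor_one (hT : IsTwistedAction A C φ T) (m : W) :
    actTensor A M T A.one (N.coact m) = A.one ⊗ₜ m := by
  have key : ∀ y : U ⊗[R] W, actTensor A M T A.one y =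
      A.one ⊗ₜ TensorProduct.lid R W (LinearMap.rTensor W C.counit y) := by
    intro y
    rw [actTensor_of_mem T A.one_mem, M.signPow_zero]
    induction y with
    | zero => simp
    | add x y h1 h2 => simp only [map_add, TensorProduct.tmul_add, h1, h2]
    | tmul c w => simp [hT.act_one, TensorProduct.smul_tmul]
  rw [key, N.counit_coact]

theorem IsTwistedAction.one_smashMul (hT : IsTwistedAction A C φ T) (x : V ⊗[R] W) :
    smashMul A N T ((A.one ⊗ₜ M.one) ⊗ₜ x) = x := by
  induction x using tensor_induction A.toGrading M.toGrading with
  | add x y h1 h2 => rw [TensorProduct.tmul_add, map_add, h1, h2]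
  | tmul i a ha j m hm =>
    rw [smashMul_tmul, N.coact_one, actTensor_of_mem T ha, leftAct_one, TensorProduct.map_tmul,
      M.signPow_of_mem i M.one_mem]
    simp [hT.one_act, M.one_mul]

theorem IsTwistedAction.smashMul_tmul_one (hT : IsTwistedAction A C φ T) (x : V ⊗[R] W) (n : W) :
    smashMul A N T (x ⊗ₜ (A.one ⊗ₜ n)) = rightAct V M n x := by
  induction x with
  | zero => simp
  | add x y h1 h2 => simp only [map_add, TensorProduct.add_tmul, h1, h2]
  | tmul a m => rw [smashMul_tmul, hT.actTensor_one]; simp [A.mul_one]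

theorem IsTwistedAction.smashMul_one (hT : IsTwistedAction A C φ T) (x : V ⊗[R] W) :
    smashMul A N T (x ⊗ₜ (A.one ⊗ₜ M.one)) = x := by
  rw [hT.smashMul_tmul_one, rightAct_one]

/-- Moving `a` past a product of `M`. -/
theorem IsTwistedAction.actTensor_mul (hT : IsTwistedAction A C φ T) (a : V) (m n : W) :
    actTensor A M T a (N.coact (M.mul m n)) =
      smashMul A N T ((A.one ⊗ₜ m) ⊗ₜ actTensor A M T a (N.coact n)) := by
  rw [N.coact_mul]
  induction a using A.toGrading.induction with
  | add x y h1 h2 => simp only [map_add, LinearMap.add_apply, TensorProduct.tmul_add, h1, h2]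
  | mem i a ha =>
    induction N.coact n using tensor_induction C.toGrading M.toGrading with
    | add x y h1 h2 => simp only [map_add, TensorProduct.tmul_add, h1, h2]
    | tmul k c' hc' l n hn =>
      have e : actTensor A M T a (c' ⊗ₜ n) = ksign R (i * l) • (T c' a ⊗ₜ n) := by
        rw [actTensor_of_mem T ha, TensorProduct.map_tmul, M.signPow_of_mem i hn,
          TensorProduct.tmul_smul]
        rfl
      rw [e, TensorProduct.tmul_smul, map_smul, smashMul_tmul, leftAct_one,
        actTensor_of_mem T ha, actTensor_of_mem T (hT.act_mem k i c' hc' a ha)]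
      induction N.coact m using tensor_induction C.toGrading M.toGrading with
      | add x y h1 h2 => simp only [map_add, TensorProduct.add_tmul, smul_add, h1, h2]
      | tmul p c hc q m hm =>
        rw [tensorMul, LinearMap.comp_apply, midSwap_tmul M.toGrading C.toGrading _ _ hm hc']
        simp only [map_smul, TensorProduct.map_tmul, TensorProduct.lift.tmul, LinearMap.flip_apply,
          M.signPow_of_mem _ hm, M.signPow_of_mem i (M.mul_mem q l m hm n hn), hT.mul_act,
          TensorProduct.tmul_smul, rightAct_tmul, smul_smul, ← ksign_add]
        congr 1
        refine ksign_congr ?_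
        simp only [parity_simps]
        tauto

/-- Moving a product of `A` past `m`. -/
theorem IsTwistedAction.mul_actTensor (hT : IsTwistedAction A C φ T) (a b : V) (m : W) :
    actTensor A M T (A.mul a b) (N.coact m) =
      smashMul A N T (actTensor A M T a (N.coact m) ⊗ₜ (b ⊗ₜ M.one)) := by
  induction a using A.toGrading.induction with
  | add x y h1 h2 => simp only [map_add, LinearMap.add_apply, TensorProduct.add_tmul, h1, h2]
  | mem i a ha =>
    induction b using A.toGrading.induction with
    | add x y h1 h2 =>
      simp only [map_add, LinearMap.add_apply, TensorProduct.tmul_add, TensorProduct.add_tmul,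
        h1, h2]
    | mem j b hb =>
      let K : U ⊗[R] (U ⊗[R] W) →ₗ[R] V ⊗[R] W := TensorProduct.lift
        ((leftAct A W ∘ₗ T.flip a).compl₂
          (TensorProduct.map (T.flip b ∘ₗ C.signPow i) (M.signPow (i + j))))
      -- both sides are `K` applied to an iterated coaction, so coassociativity identifies them
      have e1 : ∀ y : U ⊗[R] W, actTensor A M T (A.mul a b) y =
          K (TensorProduct.assoc R U U W (LinearMap.rTensor W C.comul y)) := by
        intro y
        rw [actTensor_of_mem T (A.mul_mem i j a ha b hb)]
        induction y with
        | zero => simp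
        | add x y h1 h2 => simp only [map_add, h1, h2]
        | tmul c w =>
          rw [TensorProduct.map_tmul, LinearMap.flip_apply, hT.act_mul i a ha,
            LinearMap.rTensor_tmul]
          induction C.comul c with
          | zero => simp
          | add x y h1 h2 => simp only [map_add, TensorProduct.add_tmul, h1, h2]
          | tmul u v => simp [K]
      have e2 : ∀ y : U ⊗[R] W, smashMul A N T (actTensor A M T a y ⊗ₜ (b ⊗ₜ M.one)) =
          K (LinearMap.lTensor U N.coact y) := by
        intro y
        rw [actTensor_of_mem T ha]
        induction y with
        | zero => simp
        | add x y h1 h2 => simp only [map_add, TensorProduct.add_tmul, h1, h2]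
        | tmul c w =>
          rw [TensorProduct.map_tmul, smashMul_tmul, rightAct_one, actTensor_of_mem T hb,
            map_signPow_of_degree_zero M.toGrading (tensorGrading C.toGrading M.toGrading)
              N.coact N.coact_mem, LinearMap.lTensor_tmul]
          have e : ∀ z : U ⊗[R] W, leftAct A W (T.flip a c) (TensorProduct.map (T.flip b)
              (M.signPow j) ((tensorGrading C.toGrading M.toGrading).signPow i z)) =
              K (c ⊗ₜ z) := by
            intro z
            rw [tensorGrading_signPow]
            induction z with
            | zero => simp
            | add x y h1 h2 => simp only [map_add, TensorProduct.tmul_add, h1, h2]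
            | tmul u w => simp [K, M.signPow_signPow, add_comm]
          exact e _
      rw [e1, N.coassoc, e2]

/-- After the outer factors are removed by linearity, both bracketings of
`(1 ⊗ m₁)(a₂ ⊗ m₂)(a₃ ⊗ 1)` equal the product of `(1 ⊗ m₁)(a₂ ⊗ 1)` and `(1 ⊗ m₂)(a₃ ⊗ 1)`. -/
theorem IsTwistedAction.smashMul_assoc (hT : IsTwistedAction A C φ T) (x y z : V ⊗[R] W) :
    smashMul A N T (smashMul A N T (x ⊗ₜ y) ⊗ₜ z) =
      smashMul A N T (x ⊗ₜ smashMul A N T (y ⊗ₜ z)) := by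
  have h1 : ∀ (x : V ⊗[R] W) (m : W) (a : V),
      smashMul A N T (rightAct V M m x ⊗ₜ (a ⊗ₜ M.one)) =
        smashMul A N T (x ⊗ₜ actTensor A M T a (N.coact m)) := by
    intro x m a
    induction x with
    | zero => simp
    | add x y h1 h2 => simp only [map_add, TensorProduct.add_tmul, h1, h2]
    | tmul b n =>
      have e : b ⊗ₜ[R] n = leftAct A W b (A.one ⊗ₜ n) := by simp [A.mul_one]
      rw [rightAct_tmul, smashMul_tmul, rightAct_one, hT.actTensor_mul, e, smashMul_leftAct]
  have h2 : ∀ (y : V ⊗[R] W) (m : W) (a : V),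
      smashMul A N T ((A.one ⊗ₜ m) ⊗ₜ leftAct A W a y) =
        smashMul A N T (actTensor A M T a (N.coact m) ⊗ₜ y) := by
    intro y m a
    induction y with
    | zero => simp
    | add x y h1 h2 => simp only [map_add, TensorProduct.tmul_add, h1, h2]
    | tmul b n =>
      have e : b ⊗ₜ[R] n = rightAct V M n (b ⊗ₜ M.one) := by simp [M.one_mul]
      rw [leftAct_tmul, smashMul_tmul, leftAct_one, hT.mul_actTensor, e, smashMul_rightAct]
  induction x with
  | zero => simp
  | add x x' h1 h2 => simp only [map_add, TensorProduct.add_tmul, h1, h2]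
  | tmul a₁ m₁ =>
    induction y with
    | zero => simp
    | add y y' h1 h2 => simp only [map_add, TensorProduct.tmul_add, TensorProduct.add_tmul, h1, h2]
    | tmul a₂ m₂ =>
      induction z with
      | zero => simp
      | add z z' h1 h2 => simp only [map_add, TensorProduct.tmul_add, h1, h2]
      | tmul a₃ m₃ =>
        have e1 : a₁ ⊗ₜ[R] m₁ = leftAct A W a₁ (A.one ⊗ₜ m₁) := by simp [A.mul_one]
        have e3 : a₃ ⊗ₜ[R] m₃ = rightAct V M m₃ (a₃ ⊗ₜ M.one) := by simp [M.one_mul]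
        rw [smashMul_tmul, smashMul_leftAct, e3, smashMul_rightAct, smashMul_rightAct, h1,
          smashMul_rightAct, smashMul_tmul, rightAct_one, e1, smashMul_leftAct, h2,
          leftAct_rightAct]

theorem IsTwistedAction.actTensor_mem (hT : IsTwistedAction A C φ T) {i n : ℤ} {a : V}
    (ha : a ∈ A.gr i) {y : U ⊗[R] W} (hy : y ∈ tensorGr C.toGrading M.toGrading n) :
    actTensor A M T a y ∈ tensorGr A.toGrading M.toGrading (n + i) := by
  rw [actTensor_of_mem T ha]
  refine tensorGr_induction (p := fun y => TensorProduct.map (T.flip a) (M.signPow i) y ∈ _)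
    ?_ ?_ hy
  · rintro j c hc k w hw rfl
    rw [show j + k + i = j + i + k by ring]
    exact tmul_mem_tensorGr (hT.act_mem j i c hc a ha) (M.signPow_mem i hw)
  · intro x y hx hy
    rw [map_add]
    exact add_mem hx hy

theorem IsTwistedAction.smashMul_mem (hT : IsTwistedAction A C φ T) {i j : ℤ} {x y : V ⊗[R] W}
    (hx : x ∈ tensorGr A.toGrading M.toGrading i) (hy : y ∈ tensorGr A.toGrading M.toGrading j) :
    smashMul A N T (x ⊗ₜ y) ∈ tensorGr A.toGrading M.toGrading (i + j) := by
  refine tensorGr_induction (p := fun x => smashMul A N T (x ⊗ₜ y) ∈ _) ?_ ?_ hx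
  · rintro k a ha l m hm rfl
    refine tensorGr_induction (p := fun y => smashMul A N T ((a ⊗ₜ m) ⊗ₜ y) ∈ _) ?_ ?_ hy
    · rintro k' b hb l' n hn rfl
      rw [smashMul_tmul, show k + l + (k' + l') = k + (l + k' + l') by ring]
      exact leftAct_mem ha (rightAct_mem hn (hT.actTensor_mem hb (N.coact_mem l m hm)))
    · intro y y' h h'
      rw [TensorProduct.tmul_add, map_add]
      exact add_mem h h'
  · intro x x' h h'
    rw [TensorProduct.add_tmul, map_add]
    exact add_mem h h'

end Product

/-! ### The twisted differential -/

section Differential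

variable {R V U W : Type*} [CommRing R] [AddCommGroup V] [Module R V] [AddCommGroup U] [Module R U]
  [AddCommGroup W] [Module R W] {A : DGAlgebra R V} {C : DGHopfAlgebra R U} {M : DGAlgebra R W}
  {N : DGComodule C M} {T : U →ₗ[R] V →ₗ[R] V} {φ : U →ₗ[R] V}

/-- `φ ∩ (1 ⊗ m) = ∑ φ c ⊗ m'` for `m ↦ ∑ c ⊗ m'`. -/
def capOne (N : DGComodule C M) (φ : U →ₗ[R] V) : W →ₗ[R] V ⊗[R] W :=
  LinearMap.rTensor W φ ∘ₗ N.coact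

theorem cap_tmul (a : V) (m : W) :
    cap A N φ (a ⊗ₜ m) = leftAct A W (A.sgn a) (capOne N φ m) := by
  simp only [cap, capOne, LinearMap.comp_apply, LinearMap.lTensor_tmul]
  induction N.coact m with
  | zero => simp
  | add x y h1 h2 => simp only [map_add, TensorProduct.tmul_add, h1, h2]
  | tmul c w => simp

theorem twistedD_tmul (a : V) (m : W) : twistedD A N φ (a ⊗ₜ m) =
    A.d a ⊗ₜ m + A.sgn a ⊗ₜ M.d m - leftAct A W (A.sgn a) (capOne N φ m) := by
  simp [twistedD, tensorD, cap_tmul]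

theorem twistedD_one_tmul (m : W) :
    twistedD A N φ (A.one ⊗ₜ m) = A.one ⊗ₜ M.d m - capOne N φ m := by
  simp [twistedD_tmul, A.d_one, A.sgn_one, leftAct_one]

/-- The Leibniz rule for the left action of `A`. -/
theorem twistedD_leftAct (a : V) (z : V ⊗[R] W) : twistedD A N φ (leftAct A W a z) =
    leftAct A W (A.d a) z + leftAct A W (A.sgn a) (twistedD A N φ z) := by
  induction z with
  | zero => simp
  | add x y h1 h2 => simp only [map_add, h1, h2]; abel
  | tmul b m =>
    simp only [leftAct_tmul, twistedD_tmul, A.d_mul, A.sgn_mul, map_add, map_sub,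
      TensorProduct.add_tmul, leftAct_leftAct]
    abel

theorem IsTwistedAction.capOne_mem (hT : IsTwistedAction A C φ T) {n : ℤ} {m : W}
    (hm : m ∈ M.gr n) :
    capOne N φ m ∈ tensorGr A.toGrading M.toGrading (n + 1) := by
  refine tensorGr_induction (p := fun y => LinearMap.rTensor W φ y ∈ _) ?_ ?_ (N.coact_mem n m hm)
  · rintro j c hc k w hw rfl
    rw [add_right_comm]
    exact tmul_mem_tensorGr (hT.cochain_mem j c hc) hw
  · intro x y hx hy
    rw [map_add]
    exact add_mem hx hy

theorem IsTwistedAction.twistedD_mem (hT : IsTwistedAction A C φ T) {n : ℤ} {z : V ⊗[R] W}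
    (hz : z ∈ tensorGr A.toGrading M.toGrading n) :
    twistedD A N φ z ∈ tensorGr A.toGrading M.toGrading (n + 1) := by
  refine tensorGr_induction (p := fun z => twistedD A N φ z ∈ _) ?_ ?_ hz
  · rintro i a ha j m hm rfl
    rw [twistedD_tmul]
    refine sub_mem (add_mem ?_ ?_) ?_
    · rw [add_right_comm]
      exact tmul_mem_tensorGr (A.d_mem i a ha) hm
    · rw [add_assoc]
      exact tmul_mem_tensorGr (A.sgn_mem ha) (M.d_mem j m hm)
    · rw [add_assoc]
      exact leftAct_mem (A.sgn_mem ha) (hT.capOne_mem hm)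
  · intro x y hx hy
    rw [map_add]
    exact add_mem hx hy

theorem IsTwistedAction.cochain_sgn (hT : IsTwistedAction A C φ T) (c : U) :
    A.sgn (φ c) = -φ (C.sgn c) := by
  rw [map_sgn_of_degree C.toGrading A.toGrading φ 1 hT.cochain_mem]
  simp

/-- Brown's condition for `φ`, transported to `A ⊗ M` along the coaction. -/
theorem IsTwistedAction.twistedD_twistedD_one_tmul (hT : IsTwistedAction A C φ T) (m : W) :
    twistedD A N φ (twistedD A N φ (A.one ⊗ₜ m)) = 0 := by
  let K : U ⊗[R] (U ⊗[R] W) →ₗ[R] V ⊗[R] W := TensorProduct.lift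
    ((leftAct A W ∘ₗ φ ∘ₗ C.sgn).compl₂ (LinearMap.rTensor W φ))
  have key : ∀ y : U ⊗[R] W, twistedD A N φ (LinearMap.rTensor W φ y) +
      LinearMap.rTensor W φ (tensorD C.toGrading C.d M.d y) =
      K (LinearMap.lTensor U N.coact y) -
        K (TensorProduct.assoc R U U W (LinearMap.rTensor W C.comul y)) := by
    intro y
    induction y with
    | zero => simp
    | add x y h1 h2 =>
      simp only [map_add, add_sub_add_comm, ← h1, ← h2]
      abel
    | tmul c w =>
      have e1 : K (TensorProduct.assoc R U U W (C.comul c ⊗ₜ w)) =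
          TensorProduct.lift A.mul (TensorProduct.map (φ ∘ₗ C.sgn) φ (C.comul c)) ⊗ₜ w := by
        induction C.comul c with
        | zero => simp
        | add x y h1 h2 => simp only [map_add, TensorProduct.add_tmul, h1, h2]
        | tmul u v => simp [K]
      have e2 : K (c ⊗ₜ N.coact w) = leftAct A W (φ (C.sgn c)) (capOne N φ w) := by
        simp [K, capOne]
      have hb := hT.brown c
      rw [← neg_eq_iff_eq_neg] at hb
      simp only [LinearMap.rTensor_tmul, LinearMap.lTensor_tmul, twistedD_tmul, tensorD,
        LinearMap.add_apply, TensorProduct.map_tmul, map_add, LinearMap.id_apply, e1, e2, ← hb,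
        hT.cochain_sgn, TensorProduct.neg_tmul, TensorProduct.add_tmul, map_neg,
        LinearMap.neg_apply]
      abel
  have h := key (N.coact m)
  rw [N.coassoc, sub_self, ← N.coact_d] at h
  have h' : twistedD A N φ (capOne N φ m) + capOne N φ (M.d m) = 0 := h
  rw [twistedD_one_tmul, map_sub, twistedD_one_tmul, M.d_d, TensorProduct.tmul_zero, zero_sub,
    ← neg_add', add_comm, h', neg_zero]

theorem IsTwistedAction.twistedD_twistedD (hT : IsTwistedAction A C φ T) (z : V ⊗[R] W) :
    twistedD A N φ (twistedD A N φ z) = 0 := by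
  induction z with
  | zero => simp
  | add x y h1 h2 => rw [map_add, map_add, h1, h2, add_zero]
  | tmul a m =>
    have e : a ⊗ₜ[R] m = leftAct A W a (A.one ⊗ₜ m) := by simp [A.mul_one]
    rw [e, twistedD_leftAct, map_add, twistedD_leftAct, twistedD_leftAct,
      hT.twistedD_twistedD_one_tmul, A.d_d, A.d_sgn]
    simp

/-- The sign involution of `A ⊗ M`. -/
def totalSgn (A : DGAlgebra R V) (M : DGAlgebra R W) : V ⊗[R] W →ₗ[R] V ⊗[R] W :=
  TensorProduct.map A.sgn M.sgn

theorem totalSgn_of_mem {n : ℤ} {z : V ⊗[R] W} (hz : z ∈ tensorGr A.toGrading M.toGrading n) :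
    totalSgn A M z = ksign R n • z := by
  rw [totalSgn, ← tensorGrading_sgn]
  exact (tensorGrading A.toGrading M.toGrading).sgn_of_mem' hz

theorem IsTwistedAction.totalSgn_actTensor (hT : IsTwistedAction A C φ T) (a : V) (m : W) :
    totalSgn A M (actTensor A M T a (N.coact m)) =
      actTensor A M T (A.sgn a) (N.coact (M.sgn m)) := by
  induction a using A.toGrading.induction with
  | add x y h1 h2 => simp only [map_add, LinearMap.add_apply, h1, h2]
  | mem i a ha =>
    induction m using M.toGrading.induction with
    | add x y h1 h2 => simp only [map_add, h1, h2]
    | mem j m hm =>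
      rw [totalSgn_of_mem (hT.actTensor_mem ha (N.coact_mem j m hm)), A.sgn_of_mem' ha,
        M.sgn_of_mem' hm, map_smul, map_smul, map_smul, LinearMap.smul_apply, smul_smul,
        ksign_add]

/-- The formula for `φ (b c)`, transported to `A ⊗ M` along the coaction. -/
theorem IsTwistedAction.capOne_mul (hT : IsTwistedAction A C φ T) (m n : W) :
    capOne N φ (M.mul m n) = rightAct V M n (capOne N φ m) +
      smashMul A N T ((A.one ⊗ₜ M.sgn m) ⊗ₜ capOne N φ n) := by
  have key : ∀ y : U ⊗[R] W,
      LinearMap.rTensor W φ (tensorMul C.toDGAlgebra M (N.coact m ⊗ₜ y)) =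
        rightAct V M (TensorProduct.lid R W (LinearMap.rTensor W C.counit y)) (capOne N φ m) +
          smashMul A N T ((A.one ⊗ₜ M.sgn m) ⊗ₜ LinearMap.rTensor W φ y) := by
    intro y
    induction y using tensor_induction C.toGrading M.toGrading with
    | add x y h1 h2 =>
      simp only [map_add, TensorProduct.tmul_add, LinearMap.add_apply, h1, h2]
      abel
    | tmul k c' hc' l n hn =>
      have hs : N.coact (M.sgn m) = TensorProduct.map C.sgn M.sgn (N.coact m) := by
        rw [← tensorGrading_sgn]
        exact map_signPow_of_degree_zero M.toGrading (tensorGrading C.toGrading M.toGrading)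
          N.coact N.coact_mem 1 m
      rw [LinearMap.rTensor_tmul, LinearMap.rTensor_tmul, smashMul_tmul, leftAct_one,
        actTensor_of_mem T (hT.cochain_mem k c' hc'), hs, capOne, LinearMap.comp_apply]
      induction N.coact m using tensor_induction C.toGrading M.toGrading with
      | add x y h1 h2 =>
        simp only [map_add, TensorProduct.add_tmul, h1, h2]
        abel
      | tmul p c hc q m hm =>
        -- the counit vanishes unless `k = 0`, so this sign is invisible to it
        have hk : C.counit c' • ksign R (q * k) = C.counit c' • (1 : R) := by
          by_cases hk : k = 0
          · simp [hk]
          · rw [C.counit_of_ne k hk c' hc', zero_smul, zero_smul]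
        have hk' : M.signPow (k + 1) (M.sgn m) = ksign R (q * k) • m := by
          rw [Grading.sgn, M.signPow_signPow, M.signPow_of_mem _ hm]
          congr 1
          refine ksign_congr ?_
          simp only [parity_simps]
          tauto
        rw [tensorMul, LinearMap.comp_apply, midSwap_tmul M.toGrading C.toGrading _ _ hm hc']
        simp only [map_smul, TensorProduct.map_tmul, TensorProduct.lift.tmul, hT.cochain_mul, hk',
          LinearMap.rTensor_tmul, TensorProduct.add_tmul, smul_add, LinearMap.flip_apply,
          rightAct_tmul, TensorProduct.lid_tmul, TensorProduct.tmul_smul, LinearMap.smul_apply,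
          ← TensorProduct.smul_tmul', smul_smul]
        congr 1
        rw [smul_eq_mul, smul_eq_mul, mul_one] at hk
        rw [mul_comm, hk]
  have h := key (N.coact n)
  rw [N.counit_coact, ← N.coact_mul] at h
  exact h

/-- The Leibniz rule for a product of `M`. -/
theorem IsTwistedAction.twistedD_one_tmul_mul (hT : IsTwistedAction A C φ T) (m n : W) :
    twistedD A N φ (A.one ⊗ₜ M.mul m n) = rightAct V M n (twistedD A N φ (A.one ⊗ₜ m)) +
      smashMul A N T ((A.one ⊗ₜ M.sgn m) ⊗ₜ twistedD A N φ (A.one ⊗ₜ n)) := by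
  simp only [twistedD_one_tmul, M.d_mul, hT.capOne_mul, map_sub, TensorProduct.tmul_sub,
    TensorProduct.tmul_add, rightAct_tmul, hT.smashMul_tmul_one]
  abel

/-- The Leibniz rule for the product of an element of `M` and an element of `A`. -/
theorem IsTwistedAction.twistedD_actTensor (hT : IsTwistedAction A C φ T) (a : V) (m : W) :
    twistedD A N φ (actTensor A M T a (N.coact m)) =
      smashMul A N T (twistedD A N φ (A.one ⊗ₜ m) ⊗ₜ (a ⊗ₜ M.one)) +
        smashMul A N T ((A.one ⊗ₜ M.sgn m) ⊗ₜ twistedD A N φ (a ⊗ₜ M.one)) := by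
  have h1 : twistedD A N φ (a ⊗ₜ M.one) = A.d a ⊗ₜ M.one := by
    rw [twistedD_tmul, M.d_one, capOne, LinearMap.comp_apply, N.coact_one, LinearMap.rTensor_tmul,
      hT.cochain_one]
    simp
  rw [h1, smashMul_one_tmul, twistedD_one_tmul, TensorProduct.sub_tmul, map_sub,
    smashMul_one_tmul]
  clear h1
  induction a using A.toGrading.induction with
  | add x y h1 h2 =>
    simp only [map_add, LinearMap.add_apply, TensorProduct.add_tmul, TensorProduct.tmul_add, h1, h2]
    abel
  | mem i a ha =>
    have hs : N.coact (M.sgn m) = TensorProduct.map C.sgn M.sgn (N.coact m) := by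
      rw [← tensorGrading_sgn]
      exact map_signPow_of_degree_zero M.toGrading (tensorGrading C.toGrading M.toGrading)
        N.coact N.coact_mem 1 m
    -- the two halves of the graded commutator in `d (T c a)`, on an iterated coaction
    let K₁ : U ⊗[R] (U ⊗[R] W) →ₗ[R] V ⊗[R] W := TensorProduct.lift
      ((leftAct A W ∘ₗ φ).compl₂ (TensorProduct.map (T.flip a) (M.signPow i)))
    let K₂ : U ⊗[R] (U ⊗[R] W) →ₗ[R] V ⊗[R] W := TensorProduct.lift
      ((leftAct A W ∘ₗ T.flip a ∘ₗ C.sgn).compl₂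
        (TensorProduct.map (φ ∘ₗ C.signPow i) (M.signPow i)))
    have hTs : ∀ c, A.sgn (T c a) = ksign R i • T (C.sgn c) a := fun c => by
      have h := map_sgn_of_degree C.toGrading A.toGrading (T.flip a) i
        (fun n c hc => hT.act_mem n i c hc a ha) c
      rw [LinearMap.flip_apply, LinearMap.flip_apply] at h
      rw [h, smul_smul, ksign_mul_self, one_smul]
    have hds : ∀ w, M.d (M.signPow i w) = ksign R i • M.signPow i (M.d w) := fun w => by
      induction w using M.toGrading.induction with
      | add x y h1 h2 => simp only [map_add, smul_add, h1, h2]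
      | mem n w hw =>
        rw [M.signPow_of_mem i hw, M.signPow_of_mem i (M.d_mem n w hw), map_smul, smul_smul,
          ← ksign_add]
        congr 1
        refine ksign_congr ?_
        simp only [parity_simps]
        tauto
    have hss : ∀ w, M.signPow (i + 1) (M.sgn w) = M.signPow i w := fun w => by
      rw [Grading.sgn, M.signPow_signPow, M.signPow_congr (n := i)]
      simp only [parity_simps]
      tauto
    have e1 : ∀ y : U ⊗[R] W, twistedD A N φ (TensorProduct.map (T.flip a) (M.signPow i) y) =
        TensorProduct.map (T.flip a) (M.signPow i) (tensorD C.toGrading C.d M.d y) +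
        TensorProduct.map (T.flip (A.d a)) (M.signPow (i + 1)) (TensorProduct.map C.sgn M.sgn y) -
        K₁ (TensorProduct.assoc R U U W (LinearMap.rTensor W C.comul y)) +
        ksign R i • K₂ (TensorProduct.assoc R U U W (LinearMap.rTensor W C.comul y)) -
        ksign R i • K₂ (LinearMap.lTensor U N.coact y) := by
      intro y
      induction y with
      | zero => simp
      | add x y h1 h2 => simp only [map_add, smul_add, h1, h2]; abel
      | tmul c w =>
        have k1 : K₁ (TensorProduct.assoc R U U W (C.comul c ⊗ₜ w)) =
            TensorProduct.lift A.mul (TensorProduct.map φ (T.flip a) (C.comul c)) ⊗ₜ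
              M.signPow i w := by
          induction C.comul c with
          | zero => simp
          | add x y h1 h2 => simp only [map_add, TensorProduct.add_tmul, h1, h2]
          | tmul u v => simp [K₁]
        have k2 : K₂ (TensorProduct.assoc R U U W (C.comul c ⊗ₜ w)) =
            TensorProduct.lift A.mul (TensorProduct.map (T.flip a ∘ₗ C.sgn) (φ ∘ₗ C.signPow i)
              (C.comul c)) ⊗ₜ M.signPow i w := by
          induction C.comul c with
          | zero => simp
          | add x y h1 h2 => simp only [map_add, TensorProduct.add_tmul, h1, h2]
          | tmul u v => simp [K₂]
        have k3 : K₂ (c ⊗ₜ N.coact w) =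
            leftAct A W (T (C.sgn c) a) (capOne N φ (M.signPow i w)) := by
          rw [capOne, LinearMap.comp_apply, map_signPow_of_degree_zero M.toGrading
            (tensorGrading C.toGrading M.toGrading) N.coact N.coact_mem, tensorGrading_signPow,
            LinearMap.rTensor_map]
          simp [K₂]
        rw [TensorProduct.map_tmul, twistedD_tmul, LinearMap.flip_apply, hT.d_act i a ha, hTs, hds,
          LinearMap.rTensor_tmul, LinearMap.lTensor_tmul, k1, k2, k3]
        simp only [tensorD, LinearMap.add_apply, TensorProduct.map_tmul, map_add,
          LinearMap.id_apply, LinearMap.flip_apply, hss, TensorProduct.add_tmul,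
          TensorProduct.sub_tmul, TensorProduct.tmul_smul, smul_smul, ksign_mul_self, one_smul,
          ← TensorProduct.smul_tmul', map_smul, LinearMap.smul_apply]
        abel
    have e2 : ∀ y : U ⊗[R] W, smashMul A N T (LinearMap.rTensor W φ y ⊗ₜ (a ⊗ₜ M.one)) =
        K₁ (LinearMap.lTensor U N.coact y) := by
      intro y
      induction y with
      | zero => simp
      | add x y h1 h2 => simp only [map_add, TensorProduct.add_tmul, h1, h2]
      | tmul c w =>
        rw [LinearMap.rTensor_tmul, smashMul_tmul, rightAct_one, actTensor_of_mem T ha]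
        simp [K₁]
    rw [actTensor_of_mem T ha, actTensor_of_mem T (A.d_mem i a ha), e1, N.coassoc, hs, N.coact_d,
      capOne, LinearMap.comp_apply, e2]
    abel

/-- The twisted differential is a derivation of the twisted product: it satisfies the Leibniz rule
on products `a z`, `m n` and `m a`, and these determine it on all products. -/
theorem IsTwistedAction.twistedD_smashMul (hT : IsTwistedAction A C φ T) (x y : V ⊗[R] W) :
    twistedD A N φ (smashMul A N T (x ⊗ₜ y)) = smashMul A N T (twistedD A N φ x ⊗ₜ y) +
      smashMul A N T (totalSgn A M x ⊗ₜ twistedD A N φ y) := by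
  have hL : ∀ (a : V) (m : W), a ⊗ₜ[R] m = leftAct A W a (A.one ⊗ₜ m) := fun a m => by
    simp [A.mul_one]
  have hsL : ∀ (a : V) (m : W), totalSgn A M (a ⊗ₜ m) =
      leftAct A W (A.sgn a) (A.one ⊗ₜ M.sgn m) := fun a m => by
    simp [totalSgn, A.mul_one]
  have hR : ∀ (z : V ⊗[R] W) (n : W), twistedD A N φ (rightAct V M n z) =
      rightAct V M n (twistedD A N φ z) +
        smashMul A N T (totalSgn A M z ⊗ₜ twistedD A N φ (A.one ⊗ₜ n)) := by
    intro z n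
    induction z with
    | zero => simp
    | add x y h1 h2 => simp only [map_add, TensorProduct.add_tmul, h1, h2]; abel
    | tmul a m =>
      rw [rightAct_tmul, hL a (M.mul m n), twistedD_leftAct, hT.twistedD_one_tmul_mul, hsL, hL a m,
        twistedD_leftAct, smashMul_leftAct, map_add, map_add, ← leftAct_rightAct,
        ← leftAct_rightAct, rightAct_tmul]
      abel
  induction x with
  | zero => simp
  | add x x' h1 h2 => simp only [map_add, TensorProduct.add_tmul, h1, h2]; abel
  | tmul a m =>
    induction y with
    | zero => simp
    | add y y' h1 h2 => simp only [map_add, TensorProduct.tmul_add, h1, h2]; abel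
    | tmul b n =>
      have hn : b ⊗ₜ[R] n = rightAct V M n (b ⊗ₜ M.one) := by simp [M.one_mul]
      rw [hsL, hL a m, smashMul_leftAct, twistedD_leftAct, twistedD_leftAct,
        TensorProduct.add_tmul, map_add, smashMul_leftAct, smashMul_leftAct, smashMul_leftAct,
        add_assoc, ← map_add]
      congr 2
      have hs : totalSgn A M (b ⊗ₜ M.one) = A.sgn b ⊗ₜ M.one := by simp [totalSgn, M.sgn_one]
      rw [hn, smashMul_rightAct, smashMul_one_tmul, hR, hT.twistedD_actTensor, hR, hs,
        hT.totalSgn_actTensor, smashMul_rightAct, TensorProduct.tmul_add, map_add,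
        map_add, smashMul_rightAct, ← hT.smashMul_assoc, smashMul_one_tmul]
      abel

end Differential

/-! ### The dga `A ⊗ M` -/

section Main

variable {R V U W : Type*} [CommRing R] [AddCommGroup V] [Module R V] [AddCommGroup U] [Module R U]
  [AddCommGroup W] [Module R W] {A : DGAlgebra R V} {C : DGHopfAlgebra R U} {M : DGAlgebra R W}

/-- The dga `A ⊗ M` with the twisted differential and the twisted product. -/
def IsTwistedAction.smashProduct {φ : U →ₗ[R] V} {T : U →ₗ[R] V →ₗ[R] V}
    (hT : IsTwistedAction A C φ T) (N : DGComodule C M) : DGAlgebra R (V ⊗[R] W) where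
  toGrading := tensorGrading A.toGrading M.toGrading
  d := twistedD A N φ
  mul := TensorProduct.curry (smashMul A N T)
  one := A.one ⊗ₜ M.one
  d_mem i x hx := hT.twistedD_mem hx
  d_d := hT.twistedD_twistedD
  one_mem := by
    have h := tmul_mem_tensorGr A.one_mem M.one_mem
    rwa [add_zero] at h
  mul_mem i j x hx y hy := by rw [TensorProduct.curry_apply]; exact hT.smashMul_mem hx hy
  mul_assoc x y z := by simp only [TensorProduct.curry_apply, hT.smashMul_assoc]
  one_mul x := by rw [TensorProduct.curry_apply, hT.one_smashMul]
  mul_one x := by rw [TensorProduct.curry_apply, hT.smashMul_one]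
  leibniz i v hv w := by
    rw [TensorProduct.curry_apply, TensorProduct.curry_apply, TensorProduct.curry_apply,
      hT.twistedD_smashMul, totalSgn_of_mem hv, ← TensorProduct.smul_tmul', map_smul,
      negOnePow_smul_eq (R := R)]

/-- The partial sums of the twisted multiplication are eventually stationary. -/
theorem twistedMulTerm_eventually (H : HomotopyGAlgebra A) (N : DGComodule C M)
    {φ : U →ₗ[R] V} (hφ : ∀ n, ∀ c ∈ C.gr n, φ c ∈ A.gr (n + 1))
    (z : (V ⊗[R] W) ⊗[R] (V ⊗[R] W)) :
    ∀ᶠ n in Filter.atTop, ∑ k ∈ Finset.range n, twistedMulTerm H N φ k z =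
      smashMul A N (cochainAct H C φ) z := by
  have hr := isReducedCochain_of_degree H.reduced hφ
  have hfactor : ∀ x : (V ⊗[R] U) ⊗[R] V, ∀ᶠ n in Filter.atTop,
      ∑ k ∈ Finset.range n, twistedFactor H C φ k x =
        (TensorProduct.lift A.mul ∘ₗ
          LinearMap.lTensor V (TensorProduct.lift (cochainAct H C φ)) ∘ₗ
          (TensorProduct.assoc R V U V).toLinearMap) x := by
    intro x
    induction x with
    | zero => simp
    | add x y h1 h2 =>
      filter_upwards [h1, h2] with n h1 h2
      simp only [map_add, Finset.sum_add_distrib, h1, h2]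
    | tmul x b =>
      induction x with
      | zero => simp
      | add x y h1 h2 =>
        filter_upwards [h1, h2] with n h1 h2
        simp only [map_add, TensorProduct.add_tmul, Finset.sum_add_distrib, h1, h2]
      | tmul a c =>
        filter_upwards [comulExt_eventually (ε := C.counit) (A := A) hr (C.sgn c)] with n hn
        simp [twistedFactor, cochainAct, ← map_sum, ← LinearMap.sum_apply, hn]
  have key : ∀ y : ((V ⊗[R] U) ⊗[R] V) ⊗[R] (W ⊗[R] W), ∀ᶠ n in Filter.atTop,
      ∑ k ∈ Finset.range n,
        TensorProduct.map (twistedFactor H C φ k) (TensorProduct.lift M.mul) y =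
      TensorProduct.map (TensorProduct.lift A.mul ∘ₗ
          LinearMap.lTensor V (TensorProduct.lift (cochainAct H C φ)) ∘ₗ
          (TensorProduct.assoc R V U V).toLinearMap) (TensorProduct.lift M.mul) y := by
    intro y
    induction y with
    | zero => simp
    | add x y h1 h2 =>
      filter_upwards [h1, h2] with n h1 h2
      simp only [map_add, Finset.sum_add_distrib, h1, h2]
    | tmul x m =>
      filter_upwards [hfactor x] with n hn
      simp only [TensorProduct.map_tmul, ← TensorProduct.sum_tmul, hn]
  exact key _

end Main

end TwistedTensor

end

theorem mainTheorem4 {R V U W : Type*} [CommRing R] [AddCommGroup V] [Module R V]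
    [AddCommGroup U] [Module R U] [AddCommGroup W] [Module R W]
    (A : DGAlgebra R V) (H : HomotopyGAlgebra A) (C : DGHopfAlgebra R U) (M : DGAlgebra R W)
    (N : DGComodule C M) (φ : U →ₗ[R] V) (hφ : IsMultiplicativeTwistingCochain H C φ) :
    (∀ z : (V ⊗[R] W) ⊗[R] (V ⊗[R] W),
      (Function.support fun k => twistedMulTerm H N φ k z).Finite) ∧
    ∃ B : DGAlgebra R (V ⊗[R] W),
      B.gr = tensorGr A.toGrading M.toGrading ∧
      B.d = twistedD A N φ ∧
      (∀ x y, B.mul x y = ∑ᶠ k, twistedMulTerm H N φ k (x ⊗ₜ y)) ∧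
      B.one = A.one ⊗ₜ M.one := by
  have h := fun z => finsum_eq_of_eventually (twistedMulTerm_eventually H N hφ.degree z)
  exact ⟨fun z => (h z).1, hφ.isTwistedAction.smashProduct N, rfl, rfl,
    fun x y => (h (x ⊗ₜ y)).2.symm, rfl⟩
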